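/- Let $m,n\ge 1$ be coprime integers and let $G=\langle x,y \mid x^m=y^n\rangle$ be the torus knot group of type $(m,n)$. Let $X\subset\mathbb{C}^G$ be the $SL(2,\mathbb{C})$-character variety of $G$, i.e. the set of characters $g\mapsto \operatorname{tr}\rho(g)$ of homomorphisms $\rho:G\to SL(2,\mathbb{C})$, with the topology of pointwise convergence, and let $Y\subset X$ be the set of characters of homomorphisms $G\to SU(2)\subset SL(2,\mathbb{C})$. Let $X_{red},X_{irr}$ (resp. $Y_{red},Y_{irr}$) be the sets of characters of those $SL(2,\mathbb{C})$-representations (resp. $SU(2)$-representations) which are reducible, irreducible on $\mathbb{C}^2$. Let $K$ be the set of pairs $(k,k')$ with $0<k<m$, $0<k'<n$, $k\equiv k' \pmod 2$. For $(k,k')\in K$ put $\lambda=e^{\pi i k/m}$, $\mu=e^{\pi i k'/n}$, and let $X_{irr}^{(k,k')}$ (resp. $Y_{irr}^{(k,k')}$) be the set of characters of irreducible $SL(2,\mathbb{C})$- (resp. $SU(2)$-) representations $\rho$ such that $\lambda$ is an eigenvalue of $\rho(x)$ and $\mu$ is an eigenvalue of $\rho(y)$. A *complex line* in $\mathbb{C}^G$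 is a map $\ell:\mathbb{C}\to\mathbb{C}^G$ all of whose coordinates are polynomials and such that $z$ is a polynomial in finitely many coordinates of $\ell(z)$. Then: 1. $Y=Y_{red}\cup Y_{irr}\subseteq X$ and $X_{red}\cap X_{irr}=\emptyset$. 2. $K$ has $(m-1)(n-1)/2$ elements. $X_{irr}$ is the union of the sets $X_{irr}^{(k,k')}$, $(k,k')\in K$, which are pairwise disjoint and are its connected components; $Y_{irr}$ is the union of the sets $Y_{irr}^{(k,k')}=Y\cap X_{irr}^{(k,k')}$, which are its connected components and whose closures are pairwise disjoint. 3. There is a complex line $\ell_0$ with image $X_{red}$ such that $\ell_0(t+t^{-1})$ is the character of every representation with $\rho(x)=\operatorname{diag}(t^n,t^{-n})$, $\rho(y)=\operatorname{diag}(t^m,t^{-m})$ ($t\in\mathbb{C}^*$), and $\ell_0([-2,2])=Y_{red}$. For each $q=(k,k')\in K$ there is a complex line $\ell_q$ with $\ell_q(\mathbb{C}\setminus\{0,1\})=X_{irr}^{(k,k')}$ and $\ell_q((0,1))=Y_{irr}^{(k,k')}$; in particular the open interval $Y_{irr}^{(k,k')}$ lies in the complex component $X_{irr}^{(k,k')}$.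 4. $\overline{Y_{irr}}\cap Y_{red}$ has exactly $(m-1)(n-1)$ points. There are pairwise distinct points $p_{q,0},p_{q,1}\in[-2,2]$ ($q\in K$), where, for $q=(k,k')$, $p_{q,0}=t_0+t_0^{-1}$ with $t_0^n=\lambda$, $t_0^m=\mu$, and $p_{q,1}=t_1+t_1^{-1}$ with $t_1^n=\lambda$, $t_1^m=\mu^{-1}$, such that $Y$ is homeomorphic to the space obtained from $[-2,2]$ by attaching one interval $[0,1]$ for each $q\in K$, with the ends $0,1$ glued to $p_{q,0},p_{q,1}$ (quotient topology). The homeomorphism is given by $\ell_0$ on $[-2,2]$ and by $\ell_q$ on the interval with index $q$, so it carries $[-2,2]$ onto $Y_{red}$ and the $q$-th open interval onto $Y_{irr}^{(k,k')}$. -/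

import Mathlib

noncomputable section

namespace TorusKnot

/-- The torus knot group `G = ⟨x, y ∣ x ^ m = y ^ n⟩`; the generators are
`x = FreeGroup.of 0` and `y = FreeGroup.of 1`. -/
abbrev KnotGroup (m n : ℕ) : Type :=
  PresentedGroup
    ({FreeGroup.of (0 : Fin 2) ^ m * (FreeGroup.of (1 : Fin 2) ^ n)⁻¹} : Set (FreeGroup (Fin 2)))

/-- The generator `x` of the torus knot group. -/
def genX (m n : ℕ) : KnotGroup m n := PresentedGroup.of 0

/-- The generator `y` of the torus knot group. -/
def genY (m n : ℕ) : KnotGroup m n := PresentedGroup.of 1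

/-- The group `SL(2, ℂ)`. -/
abbrev SL2C : Type := Matrix.SpecialLinearGroup (Fin 2) ℂ

/-- The group `SU(2)`. -/
abbrev SU2 : Type := Matrix.specialUnitaryGroup (Fin 2) ℂ

/-- The inclusion `SU(2) → SL(2, ℂ)`. -/
def inclSU2 : SU2 →* SL2C where
  toFun A := ⟨A.1, (Matrix.mem_specialUnitaryGroup_iff.mp A.2).2⟩
  map_one' := rfl
  map_mul' _ _ := rfl

section General

variable {G : Type*} [Group G]

/-- The character `g ↦ tr (ρ g)` of an `SL(2, ℂ)`-representation. -/
def character (ρ : G →* SL2C) : G → ℂ := fun g => Matrix.trace (ρ g).1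

/-- The linear action of `G` on `ℂ²` given by an `SL(2, ℂ)`-representation. -/
def linearRep (ρ : G →* SL2C) : Representation ℂ G (Fin 2 → ℂ) where
  toFun g := Matrix.toLin' (ρ g).1
  map_one' := by simp [Module.End.one_eq_id]
  map_mul' g h := by simp [Matrix.toLin'_mul, Module.End.mul_eq_comp]

/-- Irreducibility of an `SL(2, ℂ)`-representation. -/
def IsIrred (ρ : G →* SL2C) : Prop := (linearRep ρ).IsIrreducible

/-- An isomorphism (of affine varieties) of the complex line `ℂ` onto its image in the space
`G → ℂ` of functions on `G`: each coordinate of `ψ z` is a polynomial in `z`, and `z` is a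
polynomial in finitely many coordinates of `ψ z`. -/
def IsComplexLine (ψ : ℂ → G → ℂ) : Prop :=
  (∀ g, ∃ P : Polynomial ℂ, ∀ z, ψ z g = P.eval z) ∧
    ∃ Q : MvPolynomial G ℂ, ∀ z, MvPolynomial.eval (ψ z) Q = z

variable (G)

/-- The `SL(2, ℂ)`-character variety, a subspace of `G → ℂ` (topology of pointwise convergence). -/
def X : Set (G → ℂ) := {χ | ∃ ρ : G →* SL2C, χ = character ρ}

/-- Characters of reducible `SL(2, ℂ)`-representations. -/
def Xred : Set (G → ℂ) := {χ | ∃ ρ : G →* SL2C, ¬ IsIrred ρ ∧ χ = character ρ}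

/-- Characters of irreducible `SL(2, ℂ)`-representations. -/
def Xirr : Set (G → ℂ) := {χ | ∃ ρ : G →* SL2C, IsIrred ρ ∧ χ = character ρ}

/-- Characters of `SU(2)`-representations, inside the `SL(2, ℂ)`-character variety. -/
def Y : Set (G → ℂ) := {χ | ∃ ρ : G →* SU2, χ = character (inclSU2.comp ρ)}

/-- Characters of reducible `SU(2)`-representations. -/
def Yred : Set (G → ℂ) :=
  {χ | ∃ ρ : G →* SU2, ¬ IsIrred (inclSU2.comp ρ) ∧ χ = character (inclSU2.comp ρ)}

/-- Characters of irreducible `SU(2)`-representations. -/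
def Yirr : Set (G → ℂ) :=
  {χ | ∃ ρ : G →* SU2, IsIrred (inclSU2.comp ρ) ∧ χ = character (inclSU2.comp ρ)}

end General

/-- The pairs `(k, k')` with `0 < k < m`, `0 < k' < n` and `k ≡ k' (mod 2)`. -/
def indexPairs (m n : ℕ) : Finset (ℕ × ℕ) :=
  (Finset.Ioo 0 m ×ˢ Finset.Ioo 0 n).filter fun q => q.1 ≡ q.2 [MOD 2]

/-- The number `e ^ (π i k / m)`. -/
def eig (k m : ℕ) : ℂ := Complex.exp (Real.pi * Complex.I * k / m)

/-- `ρ x` has eigenvalue `λ = e ^ (π i k / m)` and `ρ y` has eigenvalue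
`μ = e ^ (π i k' / n)`, for `q = (k, k')`. -/
def HasEigs (m n : ℕ) (q : ℕ × ℕ) (ρ : KnotGroup m n →* SL2C) : Prop :=
  Module.End.HasEigenvalue (linearRep ρ (genX m n)) (eig q.1 m) ∧
    Module.End.HasEigenvalue (linearRep ρ (genY m n)) (eig q.2 n)

/-- The part of `Xirr` with eigenvalues prescribed by `q = (k, k')`. -/
def XirrComp (m n : ℕ) (q : ℕ × ℕ) : Set (KnotGroup m n → ℂ) :=
  {χ | ∃ ρ : KnotGroup m n →* SL2C, IsIrred ρ ∧ HasEigs m n q ρ ∧ χ = character ρ}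

/-- The part of `Yirr` with eigenvalues prescribed by `q = (k, k')`. -/
def YirrComp (m n : ℕ) (q : ℕ × ℕ) : Set (KnotGroup m n → ℂ) :=
  {χ | ∃ ρ : KnotGroup m n →* SU2, IsIrred (inclSU2.comp ρ) ∧
    HasEigs m n q (inclSU2.comp ρ) ∧ χ = character (inclSU2.comp ρ)}

/-- The gluing relation that identifies the ends `0` and `1` of the `i`-th copy of `[0, 1]` with
the points `p (i, false)` and `p (i, true)` of `B`. -/
inductive AttachRel {ι B : Type*} (p : ι × Bool → B) :
    B ⊕ ι × unitInterval → B ⊕ ι × unitInterval → Prop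
  | left (i : ι) : AttachRel p (Sum.inr (i, 0)) (Sum.inl (p (i, false)))
  | right (i : ι) : AttachRel p (Sum.inr (i, 1)) (Sum.inl (p (i, true)))

/-- The space obtained from `B` by attaching one interval for each `i : ι`, its two ends at
`p (i, false)` and `p (i, true)`, with the quotient topology. -/
abbrev Attach {ι B : Type*} (p : ι × Bool → B) : Type _ := Quot (AttachRel p)

/-- The point of the attaching space given by a point of the base. -/
def Attach.base {ι B : Type*} (p : ι × Bool → B) (b : B) : Attach p :=
  Quot.mk _ (Sum.inl b)

/-- The point of the attaching space given by a point of the `i`-th interval. -/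
def Attach.arc {ι B : Type*} (p : ι × Bool → B) (i : ι) (u : unitInterval) : Attach p :=
  Quot.mk _ (Sum.inr (i, u))

end TorusKnot

end

noncomputable section

namespace TorusKnot

section Matrices

open Matrix

/-! ### Two-by-two matrices -/

/-! By Cayley–Hamilton and its polarisation, every `ρ g` is a combination of `1`, `ρ x`, `ρ y`, `ρ x
* ρ y` with coefficients that are universal polynomials in the three traces `tr ρ(x)`, `tr ρ(y)`,
`tr ρ(xy)`. So these traces determine the character polynomially (`exists_universal_polynomial`,
`character_ext`), and all questions take place in `ℂ³`. Irreducibility is visible there too: a pair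
in `SL(2, ℂ)` has a common eigenvector iff its additive commutator is singular, that is, iff `kappa
= tr [x, y] - 2` vanishes (`isIrred_iff`).

If `ρ` is reducible, a common eigenvector has eigenvalues `a`, `b` with `a ^ m = b ^ n`; coprimality
gives `t` with `a = t ^ n`, `b = t ^ m`, and the character depends only on `t + t⁻¹`
(`exists_redLine_eq`).

If `ρ` is irreducible, `ρ(x) ^ m = ρ(y) ^ n` commutes with the image, hence is scalar, equal to
`±1`, while `ρ(x)` and `ρ(y)` are not scalar. This leaves the finitely many eigenvalue pairs indexed
by `K` (`exists_traces_of_isIrred`). Conversely, matrices with such traces satisfy the relation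
automatically (`pow_eq_pow_of_traces`), so `tr ρ(xy)` is a free coordinate on a line. On this line
`kappa` is quadratic, with its two zeros normalised to `u = 0, 1` (`HasArcTraces.kappa_eq`). For
`SU(2)`, reality of `tr ρ(xy)` and `tr [x, y] ≤ 2` force `0 < u < 1`, and every such `u` occurs
(`arcLine_image_Ioo`).

The pair `(tr ρ(x), tr ρ(y))` is continuous and separates the pieces, which are connected; this
gives the components. The gluing map is a continuous bijection from a compact space to a Hausdorff
space (`exists_homeomorph_attach`). -/

theorem mul_self_of_det_eq_one {R : Type*} [CommRing R] {A : Matrix (Fin 2) (Fin 2) R}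
    (hA : A.det = 1) : A * A = A.trace • A - 1 := by
  rw [det_fin_two] at hA
  ext i j
  fin_cases i <;> fin_cases j <;>
    simp [Matrix.mul_apply, Fin.sum_univ_two, trace_fin_two] <;>
    first | ring1 | linear_combination -hA

/-- Polarised Cayley–Hamilton: it moves `A` to the left of `B`, so that words reduce to `1`, `A`,
`B`, `A * B`. -/
theorem mul_anticomm_of_det_eq_one {R : Type*} [CommRing R] {A B : Matrix (Fin 2) (Fin 2) R} :
    B * A = -(A * B) + A.trace • B + B.trace • A + ((A * B).trace - A.trace * B.trace) • 1 := by
  ext i j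
  fin_cases i <;> fin_cases j <;>
    simp [Matrix.mul_apply, Fin.sum_univ_two, trace_fin_two] <;> ring

theorem val_mul (A B : SL2C) : (A * B).1 = A.1 * B.1 := rfl

theorem val_one : (1 : SL2C).1 = 1 := rfl

theorem val_inv (A : SL2C) : (A⁻¹).1 = A.1.trace • (1 : Matrix (Fin 2) (Fin 2) ℂ) - A.1 := by
  have h : (A⁻¹).1 = adjugate A.1 := rfl
  rw [h, adjugate_fin_two]
  ext i j
  fin_cases i <;> fin_cases j <;> simp [trace_fin_two]

theorem val_pow (A : SL2C) (k : ℕ) : (A ^ k).1 = A.1 ^ k := Matrix.SpecialLinearGroup.coe_pow A k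

theorem det_commutator (A B : Matrix (Fin 2) (Fin 2) ℂ) (hA : A.det = 1) (hB : B.det = 1) :
    (A * B - B * A).det = 4 + A.trace * B.trace * (A * B).trace
      - A.trace ^ 2 - B.trace ^ 2 - (A * B).trace ^ 2 := by
  -- Homogenised by the two determinants, the formula becomes a polynomial identity valid for all
  -- matrices.
  have key : (A * B - B * A).det = 4 * A.det * B.det + A.trace * B.trace * (A * B).trace
      - A.trace ^ 2 * B.det - B.trace ^ 2 * A.det - (A * B).trace ^ 2 := by
    simp only [det_fin_two, trace_fin_two, Matrix.sub_apply, Matrix.mul_apply, Fin.sum_univ_two]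
    ring
  rw [key, hA, hB]
  ring

theorem trace_group_commutator (A B : SL2C) :
    (A * B * A⁻¹ * B⁻¹).1.trace = A.1.trace ^ 2 + B.1.trace ^ 2 + (A.1 * B.1).trace ^ 2
      - A.1.trace * B.1.trace * (A.1 * B.1).trace - 2 := by
  -- Here `M.trace • 1 - M` is the adjugate of `M`, which is the inverse in determinant one.
  have key (M N : Matrix (Fin 2) (Fin 2) ℂ) : (M * N - N * M).det
      = 2 * M.det * N.det - (M * N * (M.trace • 1 - M) * (N.trace • 1 - N)).trace := by
    simp [det_fin_two, trace_fin_two, Matrix.mul_apply, Fin.sum_univ_two]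
    ring
  have h := key A.1 B.1
  rw [A.2, B.2, det_commutator _ _ A.2 B.2] at h
  rw [val_mul, val_mul, val_mul, val_inv, val_inv]
  linear_combination h

/-- Vectors of the plane with vanishing determinant are proportional. -/
theorem exists_smul_eq_of_det_eq_zero {v w : Fin 2 → ℂ} (hv : v ≠ 0)
    (h : v 0 * w 1 - v 1 * w 0 = 0) : ∃ c : ℂ, w = c • v := by
  by_cases h0 : v 0 = 0
  · have h1 : v 1 ≠ 0 := fun h1 => hv (by ext i; fin_cases i <;> simp [h0, h1])
    refine ⟨w 1 / v 1, ?_⟩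
    have hw : w 0 = 0 := by
      rw [h0] at h
      have : v 1 * w 0 = 0 := by linear_combination -h
      exact (mul_eq_zero.mp this).resolve_left h1
    ext i
    fin_cases i
    · simp [h0, hw]
    · simp [h1]
  · refine ⟨w 0 / v 0, ?_⟩
    ext i
    fin_cases i
    · simp [h0]
    · simp only [Fin.mk_one, Pi.smul_apply, smul_eq_mul]
      field_simp
      linear_combination h

theorem exists_smul_of_mulVec_eq_zero {M : Matrix (Fin 2) (Fin 2) ℂ} (hM : M ≠ 0)
    {v w : Fin 2 → ℂ} (hv : v ≠ 0) (hMv : M *ᵥ v = 0) (hMw : M *ᵥ w = 0) :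
    ∃ c : ℂ, w = c • v := by
  refine exists_smul_eq_of_det_eq_zero hv ?_
  by_contra hd
  refine hM ?_
  have e (u : Fin 2 → ℂ) (hu : M *ᵥ u = 0) (i : Fin 2) : M i 0 * u 0 + M i 1 * u 1 = 0 := by
    have := congrFun hu i
    simpa [mulVec, dotProduct, Fin.sum_univ_two] using this
  ext i j
  have h0 : M i 0 * (v 0 * w 1 - v 1 * w 0) = 0 := by
    linear_combination w 1 * e v hMv i - v 1 * e w hMw i
  have h1 : M i 1 * (v 0 * w 1 - v 1 * w 0) = 0 := by
    linear_combination v 0 * e w hMw i - w 0 * e v hMv i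
  fin_cases j
  · exact (mul_eq_zero.mp h0).resolve_right hd
  · exact (mul_eq_zero.mp h1).resolve_right hd

/-- Two matrices with a common eigenvector. -/
def HasCommonEigenvector (A B : Matrix (Fin 2) (Fin 2) ℂ) : Prop :=
  ∃ v : Fin 2 → ℂ, v ≠ 0 ∧ ∃ a b : ℂ, A *ᵥ v = a • v ∧ B *ᵥ v = b • v

/-- The kernel of `M` is a line, and the intertwining relations make it stable under `A` and `B`. -/
theorem hasCommonEigenvector_of_intertwining {M A B A' B' : Matrix (Fin 2) (Fin 2) ℂ}
    (hM : M ≠ 0) (hdet : M.det = 0) (hA : M * A = A' * M) (hB : M * B = B' * M) :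
    HasCommonEigenvector A B := by
  obtain ⟨v, hv, hMv⟩ := exists_mulVec_eq_zero_iff.mpr hdet
  have key {C C' : Matrix (Fin 2) (Fin 2) ℂ} (hC : M * C = C' * M) : ∃ c : ℂ, C *ᵥ v = c • v :=
    exists_smul_of_mulVec_eq_zero hM hv hMv (by
      rw [mulVec_mulVec, hC, ← mulVec_mulVec, hMv, mulVec_zero])
  obtain ⟨a, ha⟩ := key hA
  obtain ⟨b, hb⟩ := key hB
  exact ⟨v, hv, a, b, ha, hb⟩

theorem exists_det_sub_smul_one_eq_zero (A : Matrix (Fin 2) (Fin 2) ℂ) :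
    ∃ c : ℂ, (A - c • (1 : Matrix (Fin 2) (Fin 2) ℂ)).det = 0 := by
  obtain ⟨c, hc⟩ := Module.End.exists_eigenvalue (Matrix.toLin' A)
  obtain ⟨v, hv⟩ := hc.exists_hasEigenvector
  refine ⟨c, exists_mulVec_eq_zero_iff.mp ⟨v, hv.2, ?_⟩⟩
  have := hv.apply_eq_smul
  rw [toLin'_apply] at this
  rw [sub_mulVec, this, smul_mulVec, one_mulVec, sub_self]

/-- A matrix commuting with two matrices without common eigenvector is scalar. -/
theorem exists_eq_smul_one_of_commute {A B C : Matrix (Fin 2) (Fin 2) ℂ}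
    (h : ¬ HasCommonEigenvector A B) (hA : C * A = A * C) (hB : C * B = B * C) :
    ∃ c : ℂ, C = c • (1 : Matrix (Fin 2) (Fin 2) ℂ) := by
  obtain ⟨c, hc⟩ := exists_det_sub_smul_one_eq_zero C
  refine ⟨c, ?_⟩
  by_contra hne
  exact h (hasCommonEigenvector_of_intertwining (A' := A) (B' := B) (sub_ne_zero.mpr hne) hc
    (by simp [sub_mul, mul_sub, hA]) (by simp [sub_mul, mul_sub, hB]))

theorem hasCommonEigenvector_iff_det {A B : Matrix (Fin 2) (Fin 2) ℂ}
    (hA : A.det = 1) (hB : B.det = 1) :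
    HasCommonEigenvector A B ↔ (A * B - B * A).det = 0 := by
  constructor
  · rintro ⟨v, hv, a, b, ha, hb⟩
    refine exists_mulVec_eq_zero_iff.mp ⟨v, hv, ?_⟩
    rw [sub_mulVec, ← mulVec_mulVec, ← mulVec_mulVec, ha, hb, mulVec_smul, mulVec_smul, ha, hb,
      smul_smul, smul_smul, mul_comm, sub_self]
  · intro h
    by_cases h0 : A * B - B * A = 0
    -- In the commuting case, Schur's lemma makes `A` and `B` scalar unless they already share an
    -- eigenvector.
    · by_contra hne
      have hAB : A * B = B * A := sub_eq_zero.mp h0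
      obtain ⟨c, hc⟩ := exists_eq_smul_one_of_commute hne rfl hAB
      obtain ⟨d, hd⟩ := exists_eq_smul_one_of_commute hne hAB.symm rfl
      refine hne ⟨![1, 0], by simp, c, d, ?_, ?_⟩
      · rw [hc, smul_mulVec, one_mulVec]
      · rw [hd, smul_mulVec, one_mulVec]
    -- The commutator intertwines `A` with `A⁻¹` and `B` with `B⁻¹`; its kernel supplies the
    -- eigenvector.
    · refine hasCommonEigenvector_of_intertwining h0 h
        (A' := A.trace • 1 - A) (B' := B.trace • 1 - B) ?_ ?_
      · have e := mul_self_of_det_eq_one hA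
        have e1 : A * (A * B) = (A.trace • A - 1) * B := by rw [← e, mul_assoc]
        have e2 : B * (A * A) = B * (A.trace • A - 1) := by rw [e]
        simp only [sub_mul, mul_sub, smul_mul_assoc, mul_smul_comm, one_mul, mul_one,
          mul_assoc] at *
        rw [e1, e2]
        abel
      · have e := mul_self_of_det_eq_one hB
        have e1 : B * (B * A) = (B.trace • B - 1) * A := by rw [← e, mul_assoc]
        have e2 : A * (B * B) = A * (B.trace • B - 1) := by rw [e]
        simp only [sub_mul, mul_sub, smul_mul_assoc, mul_smul_comm, one_mul, mul_one,
          mul_assoc] at *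
        rw [e1, e2]
        abel

/-! ### Eigenvalues, traces and powers in `SL(2, ℂ)` -/

theorem add_inv_eq_add_inv_iff {s t : ℂ} (hs : s ≠ 0) (ht : t ≠ 0) :
    s + s⁻¹ = t + t⁻¹ ↔ s = t ∨ s = t⁻¹ := by
  constructor
  · intro h
    have : (s - t) * (s - t⁻¹) = 0 := by
      have e1 : t * t⁻¹ = 1 := mul_inv_cancel₀ ht
      have e2 : s * s⁻¹ = 1 := mul_inv_cancel₀ hs
      linear_combination s * h + e1 - e2
    rcases mul_eq_zero.mp this with h | h
    · exact Or.inl (sub_eq_zero.mp h)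
    · exact Or.inr (sub_eq_zero.mp h)
  · rintro (rfl | rfl)
    · rfl
    · rw [inv_inv, add_comm]

theorem exists_add_inv_eq (z : ℂ) : ∃ t : ℂ, t ≠ 0 ∧ t + t⁻¹ = z := by
  obtain ⟨r, hr⟩ := IsAlgClosed.exists_pow_nat_eq (z ^ 2 - 4) (n := 2) (by norm_num)
  have h : ((z + r) / 2) * ((z - r) / 2) = 1 := by linear_combination -hr / 4
  have h0 : (z + r) / 2 ≠ 0 := left_ne_zero_of_mul_eq_one h
  refine ⟨(z + r) / 2, h0, ?_⟩
  rw [inv_eq_of_mul_eq_one_right h]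
  ring

theorem hasEigenvalue_iff_trace {A : Matrix (Fin 2) (Fin 2) ℂ} (hA : A.det = 1) (c : ℂ) :
    Module.End.HasEigenvalue (toLin' A) c ↔ c ≠ 0 ∧ A.trace = c + c⁻¹ := by
  rw [Module.End.hasEigenvalue_iff_isRoot_charpoly, Matrix.charpoly_toLin', charpoly_fin_two, hA]
  simp only [map_one, Polynomial.IsRoot.def, Polynomial.eval_add, Polynomial.eval_sub,
    Polynomial.eval_pow, Polynomial.eval_X, Polynomial.eval_mul, Polynomial.eval_C,
    Polynomial.eval_one]
  constructor
  · intro h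
    have hc : c ≠ 0 := by rintro rfl; simp at h
    refine ⟨hc, ?_⟩
    field_simp
    linear_combination -h
  · rintro ⟨hc, h⟩
    rw [h]
    field_simp
    ring

theorem trace_eq_of_mulVec {A : Matrix (Fin 2) (Fin 2) ℂ} (hA : A.det = 1) {v : Fin 2 → ℂ}
    (hv : v ≠ 0) {c : ℂ} (h : A *ᵥ v = c • v) : c ≠ 0 ∧ A.trace = c + c⁻¹ := by
  rw [← hasEigenvalue_iff_trace hA]
  refine Module.End.hasEigenvalue_of_hasEigenvector (x := v) ⟨?_, hv⟩
  rw [Module.End.mem_eigenspace_iff, toLin'_apply, h]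

theorem pow_mulVec_eq {A : Matrix (Fin 2) (Fin 2) ℂ} {v : Fin 2 → ℂ} {c : ℂ}
    (h : A *ᵥ v = c • v) (k : ℕ) : (A ^ k) *ᵥ v = c ^ k • v := by
  induction k with
  | zero => simp
  | succ k ih => rw [pow_succ, ← mulVec_mulVec, h, mulVec_smul, ih, smul_smul, pow_succ']

/-- Linear interpolation of `T ^ k` at the eigenvalues `c` and `c⁻¹`, cleared of the denominator `c
- c⁻¹`. -/
theorem smul_pow_eq {A : Matrix (Fin 2) (Fin 2) ℂ} (hA : A.det = 1) {c : ℂ} (hc : c ≠ 0)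
    (ht : A.trace = c + c⁻¹) (k : ℕ) :
    (c - c⁻¹) • A ^ k = (c ^ k - (c ^ k)⁻¹) • A - (c ^ k * c⁻¹ - (c ^ k)⁻¹ * c) • 1 := by
  induction k with
  | zero =>
    ext i j
    simp only [pow_zero, inv_one, sub_self, zero_smul, one_mul, zero_sub, Matrix.smul_apply,
      Matrix.neg_apply, smul_eq_mul]
    ring
  | succ k ih =>
    rw [pow_succ, ← smul_mul_assoc, ih, sub_mul, smul_mul_assoc, mul_self_of_det_eq_one hA, ht]
    ext i j
    simp only [smul_mul_assoc, one_mul, Matrix.sub_apply, Matrix.smul_apply, smul_eq_mul]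
    field_simp
    ring

/-- A matrix of `SL(2, ℂ)` with distinct eigenvalues `c`, `c⁻¹` such that `c ^ k = e = c ^ (-k)`
has scalar `k`-th power. -/
theorem pow_eq_smul_one {A : Matrix (Fin 2) (Fin 2) ℂ} (hA : A.det = 1) {c e : ℂ}
    (hc : c ≠ 0) (hcc : c ≠ c⁻¹) (ht : A.trace = c + c⁻¹) {k : ℕ} (hk : c ^ k = e)
    (he : e⁻¹ = e) : A ^ k = e • (1 : Matrix (Fin 2) (Fin 2) ℂ) := by
  have h := smul_pow_eq hA hc ht k
  rw [hk, he, sub_self, zero_smul, zero_sub, ← neg_smul] at h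
  have : -(e * c⁻¹ - e * c) = (c - c⁻¹) * e := by ring
  rw [this, mul_smul] at h
  exact smul_right_injective _ (sub_ne_zero.mpr hcc) h

/-- A matrix of `SL(2, ℂ)` with a double eigenvalue and a scalar power is scalar. -/
theorem eq_smul_one_of_pow {A : Matrix (Fin 2) (Fin 2) ℂ} (hA : A.det = 1) {c e : ℂ}
    (hc : c * c = 1) (ht : A.trace = 2 * c) {k : ℕ} (hk : 0 < k)
    (he : A ^ k = e • (1 : Matrix (Fin 2) (Fin 2) ℂ)) (hce : c ^ k = e) :
    A = c • (1 : Matrix (Fin 2) (Fin 2) ℂ) := by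
  -- Since `c * c = 1`, one has `A = c (1 + N)` with `N = c A - 1` and `N ^ 2 = 0`; a scalar power
  -- then forces `k N = 0`.
  have key (j : ℕ) : A ^ j = c ^ j • (1 + (j : ℂ) • (c • A - 1)) := by
    induction j with
    | zero => simp
    | succ j ih =>
      rw [pow_succ, ih]
      simp only [smul_mul_assoc, add_mul, sub_mul, one_mul, mul_self_of_det_eq_one hA, ht]
      ext i l
      simp only [Matrix.sub_apply, Matrix.smul_apply, Matrix.add_apply, smul_eq_mul]
      push_cast
      linear_combination (c ^ j * (-A i l + j * A i l)) * hc
  have h := key k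
  rw [he, hce] at h
  have hc0 : c ≠ 0 := left_ne_zero_of_mul_eq_one hc
  have he0 : e ≠ 0 := hce ▸ pow_ne_zero _ hc0
  have h1 := smul_right_injective _ he0 h
  have h2 : (k : ℂ) • (c • A - 1) = 0 := left_eq_add.mp h1
  have h3 : c • A - 1 = 0 :=
    (smul_eq_zero.mp h2).resolve_left (Nat.cast_ne_zero.mpr hk.ne')
  rw [← sub_eq_zero.mp h3, smul_smul, hc, one_smul]

/-! ### Representations of the torus knot group -/

section KnotGroup

variable {m n : ℕ}

theorem genX_pow : genX m n ^ m = genY m n ^ n := by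
  have h := PresentedGroup.one_of_mem
    (rels := ({FreeGroup.of (0 : Fin 2) ^ m * (FreeGroup.of (1 : Fin 2) ^ n)⁻¹} :
      Set (FreeGroup (Fin 2)))) (Set.mem_singleton _)
  rw [map_mul, map_inv, map_pow, map_pow, mul_inv_eq_one] at h
  exact h

/-- The homomorphism from the torus knot group given by the images of the two generators. -/
def lift {H : Type*} [Group H] (A B : H) (h : A ^ m = B ^ n) : KnotGroup m n →* H :=
  PresentedGroup.toGroup (f := ![A, B]) (by
    rintro r rfl
    simp [h])

@[simp]
theorem lift_genX {H : Type*} [Group H] (A B : H) (h : A ^ m = B ^ n) :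
    lift A B h (genX m n) = A :=
  PresentedGroup.toGroup.of _

@[simp]
theorem lift_genY {H : Type*} [Group H] (A B : H) (h : A ^ m = B ^ n) :
    lift A B h (genY m n) = B :=
  PresentedGroup.toGroup.of _

theorem knotGroup_induction {C : KnotGroup m n → Prop} (one : C 1)
    (mul_x : ∀ g, C g → C (genX m n * g)) (mul_x_inv : ∀ g, C g → C ((genX m n)⁻¹ * g))
    (mul_y : ∀ g, C g → C (genY m n * g)) (mul_y_inv : ∀ g, C g → C ((genY m n)⁻¹ * g))
    (g : KnotGroup m n) : C g := by
  have hg : g ∈ Subgroup.closure (Set.range (PresentedGroup.of (rels :=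
      ({FreeGroup.of (0 : Fin 2) ^ m * (FreeGroup.of (1 : Fin 2) ^ n)⁻¹} :
        Set (FreeGroup (Fin 2)))))) := by
    rw [PresentedGroup.closure_range_of]; trivial
  induction hg using Subgroup.closure_induction_left with
  | one => exact one
  | mul_left x hx y hy ih =>
    obtain ⟨i, rfl⟩ := hx
    fin_cases i
    · exact mul_x _ ih
    · exact mul_y _ ih
  | inv_mul_cancel x hx y hy ih =>
    obtain ⟨i, rfl⟩ := hx
    fin_cases i
    · exact mul_x_inv _ ih
    · exact mul_y_inv _ ih

/-! ### Characters as polynomials in three traces -/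

theorem character_genX_mul_genY (ρ : KnotGroup m n →* SL2C) :
    character ρ (genX m n * genY m n) = ((ρ (genX m n)).1 * (ρ (genY m n)).1).trace := by
  rw [character, map_mul, val_mul]

/-- The evaluation of polynomials in three variables at the traces of `ρ x`, `ρ y`, `ρ (x y)`. -/
def evalTraces (ρ : KnotGroup m n →* SL2C) : MvPolynomial (Fin 3) ℂ →+* ℂ :=
  MvPolynomial.eval ![character ρ (genX m n), character ρ (genY m n),
    character ρ (genX m n * genY m n)]

/-- The combination of `1`, `ρ x`, `ρ y`, `ρ x * ρ y` with coefficients given by polynomials in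
the traces of `ρ x`, `ρ y` and `ρ (x y)`. -/
def combination (ρ : KnotGroup m n →* SL2C) (p q r s : MvPolynomial (Fin 3) ℂ) :
    Matrix (Fin 2) (Fin 2) ℂ :=
  evalTraces ρ p • 1 + evalTraces ρ q • (ρ (genX m n)).1 + evalTraces ρ r • (ρ (genY m n)).1
    + evalTraces ρ s • ((ρ (genX m n)).1 * (ρ (genY m n)).1)

theorem evalTraces_X_zero (ρ : KnotGroup m n →* SL2C) :
    evalTraces ρ (MvPolynomial.X 0) = (ρ (genX m n)).1.trace := by
  simp [evalTraces, character]

theorem evalTraces_X_one (ρ : KnotGroup m n →* SL2C) :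
    evalTraces ρ (MvPolynomial.X 1) = (ρ (genY m n)).1.trace := by
  simp [evalTraces, character]

theorem evalTraces_X_two (ρ : KnotGroup m n →* SL2C) :
    evalTraces ρ (MvPolynomial.X 2) = ((ρ (genX m n)).1 * (ρ (genY m n)).1).trace := by
  rw [← character_genX_mul_genY]
  simp [evalTraces]

/-- With its analogue for `y`, this makes the combinations stable under left multiplication by the
generators; inverses follow from `A⁻¹ = tr A - A`. -/
theorem genX_mul_combination (ρ : KnotGroup m n →* SL2C) (p q r s : MvPolynomial (Fin 3) ℂ) :
    (ρ (genX m n)).1 * combination ρ p q r s = combination ρ (-q) (p + MvPolynomial.X 0 * q)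
      (-s) (r + MvPolynomial.X 0 * s) := by
  have hA := mul_self_of_det_eq_one (ρ (genX m n)).2
  simp only [combination, map_add, map_mul, map_neg, evalTraces_X_zero]
  generalize (ρ (genX m n)).1 = A at hA ⊢
  simp only [mul_add, mul_smul_comm, mul_one, ← mul_assoc, hA, sub_mul, smul_mul_assoc, one_mul]
  module

theorem genY_mul_combination (ρ : KnotGroup m n →* SL2C) (p q r s : MvPolynomial (Fin 3) ℂ) :
    (ρ (genY m n)).1 * combination ρ p q r s = combination ρ
      (q * (MvPolynomial.X 2 - MvPolynomial.X 0 * MvPolynomial.X 1) - r - MvPolynomial.X 0 * s)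
      (MvPolynomial.X 1 * q + s)
      (p + MvPolynomial.X 0 * q + MvPolynomial.X 1 * r + MvPolynomial.X 2 * s) (-q) := by
  have hB := mul_self_of_det_eq_one (ρ (genY m n)).2
  simp only [combination, map_add, map_mul, map_neg, map_sub, evalTraces_X_zero,
    evalTraces_X_one, evalTraces_X_two]
  generalize (ρ (genX m n)).1 = A
  generalize (ρ (genY m n)).1 = B at hB ⊢
  have hBA : B * A = -(A * B) + A.trace • B + B.trace • A
    + ((A * B).trace - A.trace * B.trace) • 1 := mul_anticomm_of_det_eq_one
  -- The only word of length three that occurs: move the first `B` past `A`, then reduce `B * B`.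
  have hBAB : B * (A * B) = A - A.trace • 1 + (A * B).trace • B := by
    rw [← mul_assoc, hBA]
    simp only [add_mul, neg_mul, smul_mul_assoc, mul_assoc, hB, one_mul, mul_sub, mul_one,
      mul_smul_comm]
    module
  simp only [mul_add, mul_smul_comm, mul_one, hB, hBA, hBAB]
  module

theorem smul_combination_sub (ρ : KnotGroup m n →* SL2C)
    (f p q r s p' q' r' s' : MvPolynomial (Fin 3) ℂ) :
    evalTraces ρ f • combination ρ p q r s - combination ρ p' q' r' s'
      = combination ρ (f * p - p') (f * q - q') (f * r - r') (f * s - s') := by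
  simp only [combination, map_sub, map_mul]
  module

/-- The matrices `ρ g` are combinations of `1`, `ρ x`, `ρ y`, `ρ x * ρ y` whose coefficients are
universal polynomials in the traces of `ρ x`, `ρ y` and `ρ (x y)`. -/
theorem exists_eq_combination (g : KnotGroup m n) :
    ∃ p q r s : MvPolynomial (Fin 3) ℂ, ∀ ρ : KnotGroup m n →* SL2C,
      (ρ g).1 = combination ρ p q r s := by
  induction g using knotGroup_induction with
  | one =>
    refine ⟨1, 0, 0, 0, fun ρ => ?_⟩
    simp only [combination, map_one, map_zero, zero_smul, add_zero, one_smul, val_one]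
  | mul_x g ih =>
    obtain ⟨p, q, r, s, h⟩ := ih
    exact ⟨_, _, _, _, fun ρ => (show (ρ (genX m n * g)).1 = _ by rw [map_mul, val_mul, h]).trans
      (genX_mul_combination ρ p q r s)⟩
  | mul_x_inv g ih =>
    obtain ⟨p, q, r, s, h⟩ := ih
    exact ⟨_, _, _, _, fun ρ => (show (ρ ((genX m n)⁻¹ * g)).1 = _ by
      rw [map_mul, map_inv, val_mul, val_inv, sub_mul, smul_mul_assoc, one_mul, h,
        genX_mul_combination, ← evalTraces_X_zero]).trans
      (smul_combination_sub ρ (MvPolynomial.X 0) p q r s _ _ _ _)⟩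
  | mul_y g ih =>
    obtain ⟨p, q, r, s, h⟩ := ih
    exact ⟨_, _, _, _, fun ρ => (show (ρ (genY m n * g)).1 = _ by rw [map_mul, val_mul, h]).trans
      (genY_mul_combination ρ p q r s)⟩
  | mul_y_inv g ih =>
    obtain ⟨p, q, r, s, h⟩ := ih
    exact ⟨_, _, _, _, fun ρ => (show (ρ ((genY m n)⁻¹ * g)).1 = _ by
      rw [map_mul, map_inv, val_mul, val_inv, sub_mul, smul_mul_assoc, one_mul, h,
        genY_mul_combination, ← evalTraces_X_one]).trans
      (smul_combination_sub ρ (MvPolynomial.X 1) p q r s _ _ _ _)⟩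

/-- The character at `g` is a universal polynomial in the traces of `ρ x`, `ρ y`, `ρ (x y)`. -/
theorem exists_universal_polynomial (g : KnotGroup m n) :
    ∃ P : MvPolynomial (Fin 3) ℂ, ∀ ρ : KnotGroup m n →* SL2C,
      character ρ g = MvPolynomial.eval ![character ρ (genX m n), character ρ (genY m n),
        character ρ (genX m n * genY m n)] P := by
  obtain ⟨p, q, r, s, h⟩ := exists_eq_combination g
  refine ⟨2 * p + q * MvPolynomial.X 0 + r * MvPolynomial.X 1 + s * MvPolynomial.X 2,
    fun ρ => ?_⟩
  change (ρ g).1.trace = evalTraces ρ _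
  rw [h ρ, combination]
  simp only [map_add, map_mul, map_ofNat, evalTraces_X_zero, evalTraces_X_one, evalTraces_X_two,
    trace_add, trace_smul, trace_one, Fintype.card_fin, smul_eq_mul]
  push_cast
  ring

theorem character_ext {ρ σ : KnotGroup m n →* SL2C}
    (hx : character ρ (genX m n) = character σ (genX m n))
    (hy : character ρ (genY m n) = character σ (genY m n))
    (hxy : character ρ (genX m n * genY m n) = character σ (genX m n * genY m n)) :
    character ρ = character σ := by
  funext g
  obtain ⟨P, hP⟩ := exists_universal_polynomial g
  rw [hP, hP, hx, hy, hxy]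

/-- The value `tr [x, y] - 2` of a character as polynomial in its values at `x`, `y`, `x y`. -/
def kappa (χ : KnotGroup m n → ℂ) : ℂ :=
  χ (genX m n) ^ 2 + χ (genY m n) ^ 2 + χ (genX m n * genY m n) ^ 2
    - χ (genX m n) * χ (genY m n) * χ (genX m n * genY m n) - 4

theorem det_commutator_eq (ρ : KnotGroup m n →* SL2C) :
    ((ρ (genX m n)).1 * (ρ (genY m n)).1 - (ρ (genY m n)).1 * (ρ (genX m n)).1).det
      = -kappa (character ρ) := by
  rw [det_commutator _ _ (ρ (genX m n)).2 (ρ (genY m n)).2, kappa, character_genX_mul_genY]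
  simp only [character]
  ring

theorem character_commutator (ρ : KnotGroup m n →* SL2C) :
    character ρ (genX m n * genY m n * (genX m n)⁻¹ * (genY m n)⁻¹)
      = kappa (character ρ) + 2 := by
  rw [kappa, character_genX_mul_genY]
  simp only [character, map_mul, map_inv]
  rw [trace_group_commutator]
  ring

/-! ### Irreducibility read off from the character -/

theorem linearRep_apply {G : Type*} [Group G] (ρ : G →* SL2C) (g : G) (v : Fin 2 → ℂ) :
    linearRep ρ g v = (ρ g).1 *ᵥ v := rfl

/-- A proper nonzero invariant subspace of the plane is a line, and a line stable under both
generators is stable under the whole group. -/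
theorem isIrred_iff_not_hasCommonEigenvector (ρ : KnotGroup m n →* SL2C) :
    IsIrred ρ ↔ ¬ HasCommonEigenvector (ρ (genX m n)).1 (ρ (genY m n)).1 := by
  constructor
  · rintro hρ ⟨v, hv, a, b, ha, hb⟩
    have key (g : KnotGroup m n) : ∃ c : ℂ, (ρ g).1 *ᵥ v = c • v := by
      induction g using knotGroup_induction with
      | one => exact ⟨1, by rw [map_one, val_one, one_mulVec, one_smul]⟩
      | mul_x g ih =>
        obtain ⟨c, hc⟩ := ih
        exact ⟨c * a, by rw [map_mul, val_mul, ← mulVec_mulVec, hc, mulVec_smul, ha, smul_smul]⟩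
      | mul_x_inv g ih =>
        obtain ⟨c, hc⟩ := ih
        exact ⟨c * ((ρ (genX m n)).1.trace - a), by
          rw [map_mul, val_mul, ← mulVec_mulVec, hc, mulVec_smul, map_inv, val_inv, sub_mulVec,
            ha, smul_mulVec, one_mulVec, ← sub_smul, smul_smul]⟩
      | mul_y g ih =>
        obtain ⟨c, hc⟩ := ih
        exact ⟨c * b, by rw [map_mul, val_mul, ← mulVec_mulVec, hc, mulVec_smul, hb, smul_smul]⟩
      | mul_y_inv g ih =>
        obtain ⟨c, hc⟩ := ih
        exact ⟨c * ((ρ (genY m n)).1.trace - b), by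
          rw [map_mul, val_mul, ← mulVec_mulVec, hc, mulVec_smul, map_inv, val_inv, sub_mulVec,
            hb, smul_mulVec, one_mulVec, ← sub_smul, smul_smul]⟩
    let σ : Subrepresentation (linearRep ρ) :=
      { toSubmodule := Submodule.span ℂ {v}
        apply_mem_toSubmodule := by
          intro g w hw
          obtain ⟨c, rfl⟩ := Submodule.mem_span_singleton.mp hw
          obtain ⟨d, hd⟩ := key g
          rw [map_smul, linearRep_apply, hd]
          exact Submodule.smul_mem _ _ (Submodule.smul_mem _ _
            (Submodule.mem_span_singleton_self v)) }
    have : IsSimpleOrder (Subrepresentation (linearRep ρ)) := hρ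
    rcases eq_bot_or_eq_top σ with h | h
    · have h1 : Submodule.span ℂ {v} = ⊥ := congrArg Subrepresentation.toSubmodule h
      exact hv (Submodule.span_singleton_eq_bot.mp h1)
    · have h1 : Submodule.span ℂ {v} = ⊤ := congrArg Subrepresentation.toSubmodule h
      have h2 := finrank_span_singleton (K := ℂ) hv
      rw [h1, finrank_top] at h2
      simp at h2
  · intro h
    have hbot : (⊥ : Subrepresentation (linearRep ρ)) ≠ ⊤ := by
      intro e
      have h1 : (⊥ : Submodule ℂ (Fin 2 → ℂ)) = ⊤ := congrArg Subrepresentation.toSubmodule e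
      exact bot_ne_top h1
    have : Nontrivial (Subrepresentation (linearRep ρ)) := ⟨⊥, ⊤, hbot⟩
    refine IsSimpleOrder.mk fun σ => ?_
    by_contra hne
    push Not at hne
    have hσ : σ.toSubmodule ≠ ⊥ := fun e => hne.1 (Subrepresentation.toSubmodule_injective e)
    have hσ' : σ.toSubmodule ≠ ⊤ := fun e => hne.2 (Subrepresentation.toSubmodule_injective e)
    obtain ⟨v, hvσ, hv⟩ := (Submodule.ne_bot_iff _).mp hσ
    have key (g : KnotGroup m n) : ∃ c : ℂ, (ρ g).1 *ᵥ v = c • v := by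
      have hu : (ρ g).1 *ᵥ v ∈ σ.toSubmodule := σ.apply_mem_toSubmodule g hvσ
      refine exists_smul_eq_of_det_eq_zero hv ?_
      set u := (ρ g).1 *ᵥ v
      by_contra hd
      replace hd : v 0 * u 1 - u 0 * v 1 ≠ 0 := by rwa [mul_comm (u 0)]
      refine hσ' ((Submodule.eq_top_iff').mpr fun w => ?_)
      -- Cramer's rule: if `v` and `u` were independent, the invariant subspace would be the whole
      -- plane.
      have hw : w = ((w 0 * u 1 - w 1 * u 0) / (v 0 * u 1 - u 0 * v 1)) • v
          + ((v 0 * w 1 - v 1 * w 0) / (v 0 * u 1 - u 0 * v 1)) • u := by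
        ext i
        fin_cases i <;>
          simp only [Fin.zero_eta, Fin.mk_one, Pi.add_apply, Pi.smul_apply, smul_eq_mul] <;>
          rw [div_mul_eq_mul_div, div_mul_eq_mul_div, ← add_div, eq_div_iff hd] <;> ring
      rw [hw]
      exact σ.toSubmodule.add_mem (σ.toSubmodule.smul_mem _ hvσ) (σ.toSubmodule.smul_mem _ hu)
    obtain ⟨a, ha⟩ := key (genX m n)
    obtain ⟨b, hb⟩ := key (genY m n)
    exact h ⟨v, hv, a, b, ha, hb⟩

/-- A representation is irreducible if and only if the trace of the commutator is not `2`. -/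
theorem isIrred_iff (ρ : KnotGroup m n →* SL2C) : IsIrred ρ ↔ kappa (character ρ) ≠ 0 := by
  rw [isIrred_iff_not_hasCommonEigenvector,
    hasCommonEigenvector_iff_det (ρ (genX m n)).2 (ρ (genY m n)).2, det_commutator_eq,
    neg_eq_zero]

theorem hasEigenvalue_linearRep_iff (ρ : KnotGroup m n →* SL2C) (g : KnotGroup m n) {c : ℂ}
    (hc : c ≠ 0) :
    Module.End.HasEigenvalue (linearRep ρ g) c ↔ character ρ g = c + c⁻¹ := by
  have h := hasEigenvalue_iff_trace (ρ g).2 c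
  exact h.trans (and_iff_right hc)

end KnotGroup

/-! ### The numbers `e ^ (π i k / m)` -/

theorem eig_eq (k m : ℕ) : eig k m = Complex.exp ((Real.pi * k / m : ℝ) * Complex.I) := by
  rw [eig]
  congr 1
  push_cast
  ring

theorem eig_ne_zero (k m : ℕ) : eig k m ≠ 0 := Complex.exp_ne_zero _

theorem eig_re (k m : ℕ) : (eig k m).re = Real.cos (Real.pi * k / m) := by
  rw [eig_eq, Complex.exp_ofReal_mul_I_re]

theorem eig_im (k m : ℕ) : (eig k m).im = Real.sin (Real.pi * k / m) := by
  rw [eig_eq, Complex.exp_ofReal_mul_I_im]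

theorem norm_eig (k m : ℕ) : ‖eig k m‖ = 1 := by
  rw [eig_eq, Complex.norm_exp_ofReal_mul_I]

theorem eig_inv (k m : ℕ) : (eig k m)⁻¹ = (starRingEnd ℂ) (eig k m) :=
  Complex.inv_eq_conj (norm_eig k m)

theorem eig_pow {m : ℕ} (hm : 0 < m) (k : ℕ) : eig k m ^ m = (-1) ^ k := by
  rw [eig, ← Complex.exp_nat_mul, ← Complex.exp_pi_mul_I, ← Complex.exp_nat_mul]
  congr 1
  have hm' : (m : ℂ) ≠ 0 := Nat.cast_ne_zero.mpr hm.ne'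
  field_simp

/-- Lying in the open upper half-plane singles out one eigenvalue from the pair `λ`, `λ⁻¹`, the
inverse being the conjugate. -/
theorem eig_im_pos {k m : ℕ} (hk : 0 < k) (hkm : k < m) : 0 < (eig k m).im := by
  rw [eig_im]
  have hm : (0 : ℝ) < m := Nat.cast_pos.mpr (hk.trans hkm)
  have hk' : (0 : ℝ) < k := Nat.cast_pos.mpr hk
  have hkm' : (k : ℝ) < m := Nat.cast_lt.mpr hkm
  refine Real.sin_pos_of_pos_of_lt_pi (by positivity) ?_
  rw [div_lt_iff₀ hm]
  exact mul_lt_mul_of_pos_left hkm' Real.pi_pos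

theorem eig_injOn {k l m : ℕ} (hk : k < m) (hl : l < m) (h : eig k m = eig l m) : k = l := by
  have hm : (0 : ℝ) < m := Nat.cast_pos.mpr (Nat.zero_lt_of_lt hk)
  have mem {j : ℕ} (hj : j < m) : Real.pi * j / m ∈ Set.Icc 0 Real.pi := by
    refine ⟨by positivity, ?_⟩
    rw [div_le_iff₀ hm]
    exact mul_le_mul_of_nonneg_left (Nat.cast_le.mpr hj.le) Real.pi_pos.le
  have h1 := Real.injOn_cos (mem hk) (mem hl) (by rw [← eig_re, ← eig_re, h])
  field_simp at h1
  exact_mod_cast h1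

theorem eig_ne_inv {k m : ℕ} (hk : 0 < k) (hkm : k < m) : eig k m ≠ (eig k m)⁻¹ := by
  intro h
  have h1 := eig_im_pos hk hkm
  have h2 := congrArg Complex.im h
  rw [eig_inv, Complex.conj_im] at h2
  linarith

theorem eig_sub_inv {k m : ℕ} : eig k m - (eig k m)⁻¹ = (2 * (eig k m).im : ℝ) * Complex.I := by
  rw [eig_inv, Complex.sub_conj]

theorem eig_add_inv_injOn {k l m : ℕ} (hk0 : 0 < k) (hk : k < m) (hl0 : 0 < l) (hl : l < m)
    (h : eig k m + (eig k m)⁻¹ = eig l m + (eig l m)⁻¹) : k = l := by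
  rcases (add_inv_eq_add_inv_iff (eig_ne_zero _ _) (eig_ne_zero _ _)).mp h with h | h
  · exact eig_injOn hk hl h
  · have h1 := eig_im_pos hk0 hk
    have h2 := eig_im_pos hl0 hl
    rw [h, eig_inv, Complex.conj_im] at h1
    linarith

/-- Such a `c` is a `2m`-th root of unity `e ^ (π i j / m)`; `c ≠ c⁻¹` excludes `j = 0` and `j = m`,
and passing to the inverse brings `j` below `m`. -/
theorem exists_eig_of_pow_eq {m : ℕ} (hm : 0 < m) {c e : ℂ} (he : e * e = 1) (hc : c ^ m = e)
    (hcc : c ≠ c⁻¹) : ∃ k, 0 < k ∧ k < m ∧ c + c⁻¹ = eig k m + (eig k m)⁻¹ ∧ (-1) ^ k = e := by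
  have : NeZero (2 * m) := ⟨by omega⟩
  have h1 : c ^ (2 * m) = 1 := by rw [mul_comm, pow_mul, hc, sq, he]
  obtain ⟨j, hj, hjc⟩ :=
    (Complex.isPrimitiveRoot_exp (2 * m) (by omega)).eq_pow_of_pow_eq_one h1
  have hm' : (m : ℂ) ≠ 0 := Nat.cast_ne_zero.mpr hm.ne'
  have hce : c = eig j m := by
    rw [← hjc, eig, ← Complex.exp_nat_mul]
    congr 1
    push_cast
    field_simp
  have hje : (-1 : ℂ) ^ j = e := by rw [← hc, hce, eig_pow hm]
  have hj0 : j ≠ 0 := by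
    rintro rfl
    simp [hce, eig] at hcc
  have hjm : j ≠ m := by
    rintro rfl
    refine hcc ?_
    have : eig j j = -1 := by
      rw [eig, mul_div_assoc, div_self hm', mul_one, Complex.exp_pi_mul_I]
    rw [hce, this]
    norm_num
  rcases lt_or_gt_of_ne hjm with h | h
  · exact ⟨j, by omega, h, by rw [hce], hje⟩
  -- The exponent of `c⁻¹`; it has the same parity as `j`.
  · refine ⟨2 * m - j, by omega, by omega, ?_, ?_⟩
    · have : eig (2 * m - j) m = c⁻¹ := by
        rw [hce, eig, eig, ← Complex.exp_neg, Nat.cast_sub hj.le, Complex.exp_eq_exp_iff_exists_int]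
        refine ⟨1, ?_⟩
        push_cast
        field_simp
        ring
      rw [this, inv_inv, add_comm]
    · rw [← hje]
      have hs : (2 * m - j) + j = 2 * m := by omega
      have h2 : (-1 : ℂ) ^ (2 * m - j) * (-1) ^ j = 1 := by
        rw [← pow_add, hs, pow_mul]
        norm_num
      have h3 : (-1 : ℂ) ^ j * (-1) ^ j = 1 := by rw [hje, he]
      exact mul_right_cancel₀ (pow_ne_zero j (by norm_num)) (h2.trans h3.symm)

/-! ### The index pairs and their number -/

section Index

variable {m n : ℕ} {q : ℕ × ℕ}

theorem mem_indexPairs : q ∈ indexPairs m n ↔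
    (0 < q.1 ∧ q.1 < m) ∧ (0 < q.2 ∧ q.2 < n) ∧ q.1 ≡ q.2 [MOD 2] := by
  simp only [indexPairs, Finset.mem_filter, Finset.mem_product, Finset.mem_Ioo, and_assoc]

theorem neg_one_pow_eq_iff (k l : ℕ) : (-1 : ℂ) ^ k = (-1) ^ l ↔ k ≡ l [MOD 2] := by
  rw [Nat.ModEq]
  rcases Nat.even_or_odd k with hk | hk <;> rcases Nat.even_or_odd l with hl | hl <;>
    simp only [hk.neg_one_pow, hl.neg_one_pow]
  · simp [Nat.even_iff.mp hk, Nat.even_iff.mp hl]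
  · simp only [Nat.even_iff.mp hk, Nat.odd_iff.mp hl]; norm_num
  · simp only [Nat.odd_iff.mp hk, Nat.even_iff.mp hl]; norm_num
  · simp [Nat.odd_iff.mp hk, Nat.odd_iff.mp hl]

theorem eig_pow_eq_eig_pow (hq : q ∈ indexPairs m n) : eig q.1 m ^ m = eig q.2 n ^ n := by
  obtain ⟨⟨h1, h2⟩, ⟨h3, h4⟩, h5⟩ := mem_indexPairs.mp hq
  rw [eig_pow (h1.trans h2), eig_pow (h3.trans h4)]
  exact (neg_one_pow_eq_iff _ _).mpr h5

/-- By coprimality one of `m`, `n` is odd, and reflecting that coordinate exchanges pairs of equal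
parity with pairs of opposite parity. -/
theorem two_mul_card_indexPairs (hmn : Nat.Coprime m n) :
    2 * (indexPairs m n).card = (m - 1) * (n - 1) := by
  have htot : (indexPairs m n).card
      + ((Finset.Ioo 0 m ×ˢ Finset.Ioo 0 n).filter fun q => ¬ q.1 ≡ q.2 [MOD 2]).card
      = (m - 1) * (n - 1) := by
    rw [indexPairs, Finset.card_filter_add_card_filter_not, Finset.card_product, Nat.card_Ioo,
      Nat.card_Ioo]
    simp
  rw [← htot, two_mul, Nat.add_left_cancel_iff]
  have hodd : Odd m ∨ Odd n := by
    by_contra h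
    push Not at h
    rw [Nat.not_odd_iff_even, Nat.not_odd_iff_even] at h
    have := Nat.dvd_gcd h.1.two_dvd h.2.two_dvd
    rw [hmn] at this
    omega
  rcases hodd with ⟨c, hc⟩ | ⟨c, hc⟩
  · refine Finset.card_nbij' (fun q => (m - q.1, q.2)) (fun q => (m - q.1, q.2)) ?_ ?_ ?_ ?_ <;>
      intro q h <;>
      simp only [indexPairs, Finset.mem_coe, Finset.mem_filter, Finset.mem_product,
        Finset.mem_Ioo] at h ⊢ <;>
      simp only [Nat.ModEq, Prod.ext_iff] at h ⊢ <;> grind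
  · refine Finset.card_nbij' (fun q => (q.1, n - q.2)) (fun q => (q.1, n - q.2)) ?_ ?_ ?_ ?_ <;>
      intro q h <;>
      simp only [indexPairs, Finset.mem_coe, Finset.mem_filter, Finset.mem_product,
        Finset.mem_Ioo] at h ⊢ <;>
      simp only [Nat.ModEq, Prod.ext_iff] at h ⊢ <;> grind

end Index

/-! ### Irreducible representations -/

section Irreducible

variable {m n : ℕ}

/-- A matrix of `SL(2, ℂ)` with scalar `m`-th power that is not scalar has eigenvalues
`e ^ (± π i k / m)` with `0 < k < m`. -/
theorem exists_eig_of_pow_eq_smul_one (hm : 0 < m) {A : Matrix (Fin 2) (Fin 2) ℂ}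
    (hA : A.det = 1) {e : ℂ} (he : e * e = 1) (hpow : A ^ m = e • (1 : Matrix (Fin 2) (Fin 2) ℂ))
    (hne : ∀ c : ℂ, A ≠ c • (1 : Matrix (Fin 2) (Fin 2) ℂ)) :
    ∃ k, 0 < k ∧ k < m ∧ A.trace = eig k m + (eig k m)⁻¹ ∧ (-1) ^ k = e := by
  obtain ⟨c, hc⟩ := exists_det_sub_smul_one_eq_zero A
  obtain ⟨v, hv, hcv⟩ := exists_mulVec_eq_zero_iff.mpr hc
  rw [sub_mulVec, smul_mulVec, one_mulVec, sub_eq_zero] at hcv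
  obtain ⟨hc0, htr⟩ := trace_eq_of_mulVec hA hv hcv
  have hcm : c ^ m = e := by
    have h1 := pow_mulVec_eq hcv m
    rw [hpow, smul_mulVec, one_mulVec] at h1
    exact (smul_left_injective ℂ hv h1).symm
  rw [htr]
  refine exists_eig_of_pow_eq hm he hcm fun hcc => ?_
  have h2 : c * c = 1 := by
    nth_rewrite 2 [hcc]
    exact mul_inv_cancel₀ hc0
  refine hne c (eq_smul_one_of_pow hA h2 ?_ hm hpow hcm)
  rw [htr, ← hcc, two_mul]

theorem exists_traces_of_isIrred (hm : 0 < m) (hn : 0 < n) {ρ : KnotGroup m n →* SL2C}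
    (hρ : IsIrred ρ) : ∃ q ∈ indexPairs m n,
      character ρ (genX m n) = eig q.1 m + (eig q.1 m)⁻¹ ∧
      character ρ (genY m n) = eig q.2 n + (eig q.2 n)⁻¹ := by
  rw [isIrred_iff_not_hasCommonEigenvector] at hρ
  have hAB : (ρ (genX m n)).1 ^ m = (ρ (genY m n)).1 ^ n := by
    rw [← val_pow, ← val_pow, ← map_pow, ← map_pow, genX_pow]
  have hA := (ρ (genX m n)).2
  have hB := (ρ (genY m n)).2
  simp only [character]
  generalize (ρ (genX m n)).1 = A at *
  generalize (ρ (genY m n)).1 = B at *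
  -- The common power commutes with both generators, so it is a scalar `e`; taking determinants
  -- gives `e * e = 1`.
  obtain ⟨e, he⟩ := exists_eq_smul_one_of_commute (C := A ^ m) hρ
    ((Commute.refl A).pow_left m) (by rw [hAB]; exact (Commute.refl B).pow_left n)
  have hee : e * e = 1 := by
    have h := congrArg det he
    rw [det_pow, hA, one_pow, det_smul, det_one, mul_one, Fintype.card_fin, sq] at h
    exact h.symm
  -- Excludes that either generator is scalar.
  have hcomm (h : A * B = B * A) : False := by
    refine hρ ((hasCommonEigenvector_iff_det hA hB).mpr ?_)
    rw [h, sub_self, det_zero]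
  obtain ⟨k, hk0, hkm, hk, hke⟩ := exists_eig_of_pow_eq_smul_one hm hA hee he (by
    rintro c rfl
    exact hcomm (by simp))
  obtain ⟨l, hl0, hln, hl, hle⟩ := exists_eig_of_pow_eq_smul_one hn hB hee (hAB ▸ he) (by
    rintro c rfl
    exact hcomm (by simp))
  exact ⟨(k, l), mem_indexPairs.mpr ⟨⟨hk0, hkm⟩, ⟨hl0, hln⟩,
    (neg_one_pow_eq_iff _ _).mp (hke.trans hle.symm)⟩, hk, hl⟩

theorem hasEigs_iff {q : ℕ × ℕ} {ρ : KnotGroup m n →* SL2C} : HasEigs m n q ρ ↔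
    character ρ (genX m n) = eig q.1 m + (eig q.1 m)⁻¹ ∧
      character ρ (genY m n) = eig q.2 n + (eig q.2 n)⁻¹ := by
  rw [HasEigs, hasEigenvalue_linearRep_iff _ _ (eig_ne_zero _ _),
    hasEigenvalue_linearRep_iff _ _ (eig_ne_zero _ _)]

/-- The trace of `ρ (x y)` on the line of characters with index `q`, as function of the
coordinate on the line. -/
def arcTrace (m n : ℕ) (q : ℕ × ℕ) (u : ℂ) : ℂ :=
  (1 - u) * (eig q.1 m * eig q.2 n + (eig q.1 m * eig q.2 n)⁻¹)
    + u * (eig q.1 m * (eig q.2 n)⁻¹ + (eig q.1 m * (eig q.2 n)⁻¹)⁻¹)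

theorem arcTrace_eq (m n : ℕ) (q : ℕ × ℕ) (u : ℂ) :
    arcTrace m n q u = arcTrace m n q 0
      - (eig q.1 m - (eig q.1 m)⁻¹) * (eig q.2 n - (eig q.2 n)⁻¹) * u := by
  simp only [arcTrace, mul_inv, inv_inv]
  ring

/-- Since `λ` and `μ` differ from their inverses, the trace at `x y` is an affine function of `u`
with nonzero slope, hence a coordinate. -/
theorem arc_slope_ne_zero {q : ℕ × ℕ} (hq : q ∈ indexPairs m n) :
    (eig q.1 m - (eig q.1 m)⁻¹) * (eig q.2 n - (eig q.2 n)⁻¹) ≠ 0 := by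
  obtain ⟨⟨h1, h2⟩, ⟨h3, h4⟩, -⟩ := mem_indexPairs.mp hq
  exact mul_ne_zero (sub_ne_zero.mpr (eig_ne_inv h1 h2)) (sub_ne_zero.mpr (eig_ne_inv h3 h4))

/-- The values at `x`, `y` and `x y` of the point with coordinate `u` on the line of index `q`. -/
def HasArcTraces (q : ℕ × ℕ) (u : ℂ) (χ : KnotGroup m n → ℂ) : Prop :=
  χ (genX m n) = eig q.1 m + (eig q.1 m)⁻¹ ∧ χ (genY m n) = eig q.2 n + (eig q.2 n)⁻¹ ∧
    χ (genX m n * genY m n) = arcTrace m n q u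

/-- As a quadratic in the trace at `x y`, `kappa` has the roots `λμ + (λμ)⁻¹` and `λμ⁻¹ + λ⁻¹μ`,
which are the values at `u = 0` and `u = 1`. -/
theorem HasArcTraces.kappa_eq {q : ℕ × ℕ} {u : ℂ} {χ : KnotGroup m n → ℂ}
    (h : HasArcTraces q u χ) : kappa χ =
      -((eig q.1 m - (eig q.1 m)⁻¹) * (eig q.2 n - (eig q.2 n)⁻¹)) ^ 2 * (u * (1 - u)) := by
  obtain ⟨h1, h2, h3⟩ := h
  rw [kappa, h1, h2, h3, arcTrace]
  have := eig_ne_zero q.1 m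
  have := eig_ne_zero q.2 n
  field_simp
  ring

theorem HasArcTraces.kappa_ne_zero_iff {q : ℕ × ℕ} (hq : q ∈ indexPairs m n) {u : ℂ}
    {χ : KnotGroup m n → ℂ} (h : HasArcTraces q u χ) :
    kappa χ ≠ 0 ↔ u ∈ ({0, 1}ᶜ : Set ℂ) := by
  rw [h.kappa_eq]
  have h1 := arc_slope_ne_zero hq
  have h2 : -((eig q.1 m - (eig q.1 m)⁻¹) * (eig q.2 n - (eig q.2 n)⁻¹)) ^ 2 ≠ 0 :=
    neg_ne_zero.mpr (pow_ne_zero 2 h1)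
  rw [mul_ne_zero_iff, mul_ne_zero_iff, sub_ne_zero]
  simp only [h2, ne_eq, not_false_eq_true, true_and, Set.mem_compl_iff, Set.mem_insert_iff,
    Set.mem_singleton_iff, not_or]
  exact and_congr_right fun _ => not_congr eq_comm

theorem exists_hasArcTraces {q : ℕ × ℕ} (hq : q ∈ indexPairs m n) {χ : KnotGroup m n → ℂ}
    (hx : χ (genX m n) = eig q.1 m + (eig q.1 m)⁻¹)
    (hy : χ (genY m n) = eig q.2 n + (eig q.2 n)⁻¹) :
    ∃ u : ℂ, HasArcTraces q u χ := by
  refine ⟨(arcTrace m n q 0 - χ (genX m n * genY m n)) /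
    ((eig q.1 m - (eig q.1 m)⁻¹) * (eig q.2 n - (eig q.2 n)⁻¹)), hx, hy, ?_⟩
  rw [arcTrace_eq, mul_div_cancel₀ _ (arc_slope_ne_zero hq)]
  ring

theorem eig_pow_inv (hm : 0 < m) (k : ℕ) : (eig k m ^ m)⁻¹ = eig k m ^ m := by
  rw [eig_pow hm, ← inv_pow]
  norm_num

/-- Matrices of `SL(2, ℂ)` with the traces prescribed by `q` satisfy the relation of the torus
knot group. -/
theorem pow_eq_pow_of_traces {q : ℕ × ℕ} (hq : q ∈ indexPairs m n)
    {A B : Matrix (Fin 2) (Fin 2) ℂ} (hA : A.det = 1) (hB : B.det = 1)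
    (hAt : A.trace = eig q.1 m + (eig q.1 m)⁻¹) (hBt : B.trace = eig q.2 n + (eig q.2 n)⁻¹) :
    A ^ m = B ^ n := by
  obtain ⟨⟨h1, h2⟩, ⟨h3, h4⟩, -⟩ := mem_indexPairs.mp hq
  rw [pow_eq_smul_one hA (eig_ne_zero _ _) (eig_ne_inv h1 h2) hAt rfl
      (eig_pow_inv (h1.trans h2) _),
    pow_eq_smul_one hB (eig_ne_zero _ _) (eig_ne_inv h3 h4) hBt rfl
      (eig_pow_inv (h3.trans h4) _), eig_pow_eq_eig_pow hq]

theorem exists_rep_hasArcTraces {q : ℕ × ℕ} (hq : q ∈ indexPairs m n) (u : ℂ) :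
    ∃ ρ : KnotGroup m n →* SL2C, HasArcTraces q u (character ρ) := by
  have hc := eig_ne_zero q.1 m
  have hd := eig_ne_zero q.2 n
  set c := eig q.1 m with hc'
  set d := eig q.2 n with hd'
  -- As `A` is diagonal, `tr (A B)` sees only the diagonal of `B`, which interpolates between `(d,
  -- d⁻¹)` and `(d⁻¹, d)`; the lower left entry is chosen to give determinant one.
  let A : SL2C := ⟨!![c, 0; 0, c⁻¹], by rw [det_fin_two_of]; field_simp; ring⟩
  let B : SL2C := ⟨!![(1 - u) * d + u * d⁻¹, 1;
    ((1 - u) * d + u * d⁻¹) * ((1 - u) * d⁻¹ + u * d) - 1, (1 - u) * d⁻¹ + u * d], by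
      rw [det_fin_two_of]; ring⟩
  have hA : A.1.trace = c + c⁻¹ := by simp [A, trace_fin_two]
  have hB : B.1.trace = d + d⁻¹ := by simp [B, trace_fin_two]; ring
  have h : A ^ m = B ^ n := Subtype.ext (by
    rw [val_pow, val_pow]
    exact pow_eq_pow_of_traces hq A.2 B.2 hA hB)
  refine ⟨lift A B h, ?_, ?_, ?_⟩
  · rw [character, lift_genX, hA]
  · rw [character, lift_genY, hB]
  · rw [character_genX_mul_genY, lift_genX, lift_genY, arcTrace, ← hc', ← hd']
    simp [A, B, trace_fin_two]
    ring

end Irreducible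

/-! ### The group `SU(2)` -/

/-- The element of `SU(2)` with first row `(a, b)`. -/
def mkSU2 (a b : ℂ) (h : Complex.normSq a + Complex.normSq b = 1) : SU2 :=
  ⟨!![a, b; -(starRingEnd ℂ) b, (starRingEnd ℂ) a], by
    have h' : a * (starRingEnd ℂ) a + b * (starRingEnd ℂ) b = 1 := by
      rw [Complex.mul_conj, Complex.mul_conj, ← Complex.ofReal_add, h, Complex.ofReal_one]
    rw [mem_specialUnitaryGroup_iff, mem_unitaryGroup_iff]
    constructor
    · ext i j
      fin_cases i <;> fin_cases j <;>
        simp [Matrix.mul_apply, Fin.sum_univ_two, star_apply] <;>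
        first | ring1 | linear_combination h'
    · rw [det_fin_two_of]
      linear_combination h'⟩

theorem inclSU2_val (A : SU2) : (inclSU2 A).1 = A.1 := rfl

theorem exists_real_trace (A : SU2) :
    ∃ r ∈ Set.Icc (-2 : ℝ) 2, (inclSU2 A).1.trace = (r : ℂ) := by
  obtain ⟨hU, hdet⟩ := mem_specialUnitaryGroup_iff.mp A.2
  -- Both are the inverse of `A`; comparing entries shows the diagonal to be a conjugate pair.
  have h1 : adjugate A.1 = star A.1 := by
    calc adjugate A.1 = adjugate A.1 * (A.1 * star A.1) := by
          rw [mem_unitaryGroup_iff.mp hU, mul_one]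
      _ = star A.1 := by rw [← mul_assoc, adjugate_mul, hdet, one_smul, one_mul]
  have h2 : A.1 1 1 = (starRingEnd ℂ) (A.1 0 0) := by
    have := congrFun (congrFun h1 0) 0
    rw [adjugate_fin_two] at this
    simpa [star_apply] using this
  have h3 : |(A.1 0 0).re| ≤ 1 :=
    (Complex.abs_re_le_norm _).trans (entry_norm_bound_of_unitary hU 0 0)
  refine ⟨2 * (A.1 0 0).re, ?_, ?_⟩
  · rw [abs_le] at h3
    constructor <;> linarith [h3.1, h3.2]
  · rw [inclSU2_val, trace_fin_two, h2, Complex.add_conj]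

/-! ### The line of reducible characters -/

section Reducible

variable {m n : ℕ}

theorem trace_pow_eq {A : Matrix (Fin 2) (Fin 2) ℂ} (hA : A.det = 1) {t : ℂ} (ht : t ≠ 0)
    (htr : A.trace = t + t⁻¹) (k : ℕ) : (A ^ k).trace = t ^ k + (t ^ k)⁻¹ := by
  obtain ⟨v, hv⟩ := ((hasEigenvalue_iff_trace hA t).mpr ⟨ht, htr⟩).exists_hasEigenvector
  have h := hv.apply_eq_smul
  rw [toLin'_apply] at h
  exact (trace_eq_of_mulVec (by rw [det_pow, hA, one_pow]) hv.2 (pow_mulVec_eq h k)).2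

/-- Bézout: if `m u + n v = 1`, then `t = a ^ v * b ^ u` works. -/
theorem exists_pow_eq_of_coprime (hmn : Nat.Coprime m n) {a b : ℂ} (ha : a ≠ 0) (hb : b ≠ 0)
    (hab : a ^ m = b ^ n) : ∃ t : ℂ, t ≠ 0 ∧ t ^ n = a ∧ t ^ m = b := by
  have hg : (m : ℤ) * m.gcdA n + n * m.gcdB n = 1 := by
    rw [← Nat.gcd_eq_gcd_ab, hmn]; rfl
  have hab' : a ^ (m : ℤ) = b ^ (n : ℤ) := by rw [zpow_natCast, zpow_natCast, hab]
  refine ⟨a ^ m.gcdB n * b ^ m.gcdA n, mul_ne_zero (zpow_ne_zero _ ha) (zpow_ne_zero _ hb), ?_, ?_⟩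
  · rw [mul_pow, ← zpow_natCast, ← zpow_natCast, ← _root_.zpow_mul, ← _root_.zpow_mul,
      mul_comm _ (n : ℤ), mul_comm _ (n : ℤ), _root_.zpow_mul b, ← hab', ← _root_.zpow_mul, ← zpow_add₀ ha, add_comm, hg,
      zpow_one]
  · rw [mul_pow, ← zpow_natCast, ← zpow_natCast, ← _root_.zpow_mul, ← _root_.zpow_mul,
      mul_comm _ (m : ℤ), mul_comm _ (m : ℤ), _root_.zpow_mul a, hab', ← _root_.zpow_mul, ← zpow_add₀ hb, add_comm, hg,
      zpow_one]

/-- The representation with `x ↦ S ^ n` and `y ↦ S ^ m`. -/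
def cyclicRep (m n : ℕ) {H : Type*} [Group H] (S : H) : KnotGroup m n →* H :=
  lift (S ^ n) (S ^ m) (by rw [← pow_mul, ← pow_mul, mul_comm])

/-- An element whose image in the abelianization `ℤ` is a generator. -/
def genZ (m n : ℕ) : KnotGroup m n := genX m n ^ m.gcdB n * genY m n ^ m.gcdA n

theorem cyclicRep_genZ (hmn : Nat.Coprime m n) {H : Type*} [Group H] (S : H) :
    cyclicRep m n S (genZ m n) = S := by
  have hg : (m : ℤ) * m.gcdA n + n * m.gcdB n = 1 := by
    rw [← Nat.gcd_eq_gcd_ab, hmn]; rfl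
  rw [genZ, map_mul, map_zpow, map_zpow, cyclicRep, lift_genX, lift_genY, ← zpow_natCast,
    ← zpow_natCast, ← _root_.zpow_mul, ← _root_.zpow_mul, ← _root_.zpow_add, add_comm, hg,
      zpow_one]

theorem comp_cyclicRep {H H' : Type*} [Group H] [Group H'] (f : H →* H') (S : H) :
    f.comp (cyclicRep m n S) = cyclicRep m n (f S) := by
  refine PresentedGroup.ext fun i => ?_
  fin_cases i
  · change f (cyclicRep m n S (genX m n)) = cyclicRep m n (f S) (genX m n)
    rw [cyclicRep, cyclicRep, lift_genX, lift_genX, map_pow]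
  · change f (cyclicRep m n S (genY m n)) = cyclicRep m n (f S) (genY m n)
    rw [cyclicRep, cyclicRep, lift_genY, lift_genY, map_pow]

/-- The values at `x`, `y` and `x y` of the reducible character with parameter `t`. -/
def HasLineTraces (t : ℂ) (χ : KnotGroup m n → ℂ) : Prop :=
  χ (genX m n) = t ^ n + (t ^ n)⁻¹ ∧ χ (genY m n) = t ^ m + (t ^ m)⁻¹ ∧
    χ (genX m n * genY m n) = t ^ n * t ^ m + (t ^ n * t ^ m)⁻¹

theorem hasLineTraces_cyclicRep {S : SL2C} {t : ℂ} (ht : t ≠ 0) (hS : S.1.trace = t + t⁻¹) :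
    HasLineTraces t (character (cyclicRep m n S)) := by
  refine ⟨?_, ?_, ?_⟩
  · rw [character, cyclicRep, lift_genX, val_pow, trace_pow_eq S.2 ht hS]
  · rw [character, cyclicRep, lift_genY, val_pow, trace_pow_eq S.2 ht hS]
  · rw [character_genX_mul_genY, cyclicRep, lift_genX, lift_genY, val_pow, val_pow, ← pow_add,
      trace_pow_eq S.2 ht hS, pow_add]

theorem HasLineTraces.eq {t : ℂ} {ρ σ : KnotGroup m n →* SL2C}
    (hρ : HasLineTraces t (character ρ)) (hσ : HasLineTraces t (character σ)) :
    character ρ = character σ :=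
  character_ext (hρ.1.trans hσ.1.symm) (hρ.2.1.trans hσ.2.1.symm) (hρ.2.2.trans hσ.2.2.symm)

/-- The companion matrix of `T ^ 2 - z T + 1`. -/
def companion (z : ℂ) : SL2C := ⟨!![z, -1; 1, 0], by rw [det_fin_two_of]; ring⟩

theorem trace_companion (z : ℂ) : (companion z).1.trace = z := by
  simp [companion, trace_fin_two]

/-- The line of reducible characters. -/
def redLine (m n : ℕ) (z : ℂ) : KnotGroup m n → ℂ := character (cyclicRep m n (companion z))

theorem hasLineTraces_redLine {t : ℂ} (ht : t ≠ 0) :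
    HasLineTraces t (redLine m n (t + t⁻¹)) :=
  hasLineTraces_cyclicRep ht (trace_companion _)

/-- Only the trace of `S` matters, because it determines the traces of all powers of `S`,
diagonalisable or not. -/
theorem character_cyclicRep (S : SL2C) :
    character (cyclicRep m n S) = redLine m n S.1.trace := by
  obtain ⟨t, ht, h⟩ := exists_add_inv_eq S.1.trace
  rw [← h]
  exact (hasLineTraces_cyclicRep ht h.symm).eq (hasLineTraces_redLine ht)

theorem redLine_genZ (hmn : Nat.Coprime m n) (z : ℂ) : redLine m n z (genZ m n) = z := by
  rw [redLine, character, cyclicRep_genZ hmn, trace_companion]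

theorem not_isIrred_cyclicRep (S : SL2C) : ¬ IsIrred (cyclicRep m n S) := by
  rw [isIrred_iff_not_hasCommonEigenvector, not_not,
    hasCommonEigenvector_iff_det (cyclicRep m n S _).2 (cyclicRep m n S _).2, cyclicRep,
    lift_genX, lift_genY, val_pow, val_pow, ← pow_add, ← pow_add, add_comm, sub_self, det_zero]

theorem kappa_redLine (z : ℂ) : kappa (redLine m n z) = 0 := by
  by_contra h
  exact not_isIrred_cyclicRep (companion z) ((isIrred_iff _).mpr h)

/-- On a common eigenvector `x`, `y`, `x y` act by `a`, `b`, `a b`; determinant one turns these into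
the three traces. -/
theorem exists_redLine_eq (hmn : Nat.Coprime m n) {ρ : KnotGroup m n →* SL2C}
    (hρ : ¬ IsIrred ρ) : ∃ z, redLine m n z = character ρ := by
  rw [isIrred_iff_not_hasCommonEigenvector, not_not] at hρ
  obtain ⟨v, hv, a, b, ha, hb⟩ := hρ
  obtain ⟨ha0, hat⟩ := trace_eq_of_mulVec (ρ (genX m n)).2 hv ha
  obtain ⟨hb0, hbt⟩ := trace_eq_of_mulVec (ρ (genY m n)).2 hv hb
  have hAB : (ρ (genX m n)).1 ^ m = (ρ (genY m n)).1 ^ n := by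
    rw [← val_pow, ← val_pow, ← map_pow, ← map_pow, genX_pow]
  have hab : a ^ m = b ^ n := by
    have h1 := pow_mulVec_eq ha m
    rw [hAB, pow_mulVec_eq hb n] at h1
    exact (smul_left_injective ℂ hv h1).symm
  have habv : ((ρ (genX m n)).1 * (ρ (genY m n)).1) *ᵥ v = (a * b) • v := by
    rw [← mulVec_mulVec, hb, mulVec_smul, ha, smul_smul, mul_comm]
  obtain ⟨-, habt⟩ := trace_eq_of_mulVec (by rw [det_mul, (ρ _).2, (ρ _).2, one_mul]) hv habv
  obtain ⟨t, ht, hta, htb⟩ := exists_pow_eq_of_coprime hmn ha0 hb0 hab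
  refine ⟨t + t⁻¹, (hasLineTraces_redLine ht).eq (ρ := cyclicRep m n (companion _)) ⟨?_, ?_, ?_⟩⟩
  · rw [hta]; exact hat
  · rw [htb]; exact hbt
  · rw [hta, htb, character_genX_mul_genY]; exact habt

theorem redLine_isComplexLine (hmn : Nat.Coprime m n) : IsComplexLine (redLine m n) := by
  refine ⟨fun g => ?_, MvPolynomial.X (genZ m n), fun z => by
    rw [MvPolynomial.eval_X, redLine_genZ hmn]⟩
  -- The companion matrix with indeterminate `z`: traces of its powers are polynomials in `z`. The
  -- inverse coordinate is evaluation at `genZ`.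
  let M : Matrix (Fin 2) (Fin 2) (Polynomial ℂ) := !![Polynomial.X, -1; 1, 0]
  have hM (k : ℕ) (z : ℂ) : ((companion z).1 ^ k).trace = (M ^ k).trace.eval z := by
    have h1 : (companion z).1 = (Polynomial.evalRingHom z).mapMatrix M := by
      ext i j
      fin_cases i <;> fin_cases j <;> simp [companion, M]
    rw [h1, ← map_pow]
    simp [trace_fin_two]
  obtain ⟨P, hP⟩ := exists_universal_polynomial g
  refine ⟨MvPolynomial.aeval ![(M ^ n).trace, (M ^ m).trace, (M ^ (n + m)).trace] P, fun z => ?_⟩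
  rw [redLine, hP, character_genX_mul_genY, character, character, cyclicRep, lift_genX, lift_genY,
    val_pow, val_pow, ← pow_add, hM, hM, hM, ← Polynomial.coe_evalRingHom, MvPolynomial.aeval_def,
    MvPolynomial.hom_eval₂, MvPolynomial.eval, MvPolynomial.coe_eval₂Hom]
  congr 1
  · ext; simp
  · ext i; fin_cases i <;> simp

theorem range_redLine (hmn : Nat.Coprime m n) :
    Set.range (redLine m n) = Xred (KnotGroup m n) := by
  ext χ
  constructor
  · rintro ⟨z, rfl⟩
    exact ⟨_, not_isIrred_cyclicRep _, rfl⟩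
  · rintro ⟨ρ, hρ, rfl⟩
    exact exists_redLine_eq hmn hρ

theorem redLine_image_Icc (hmn : Nat.Coprime m n) :
    (fun s : ℝ => redLine m n (s : ℂ)) '' Set.Icc (-2) 2 = Yred (KnotGroup m n) := by
  ext χ
  constructor
  · rintro ⟨s, ⟨hs1, hs2⟩, rfl⟩
    -- First row `(s/2, √(1 - s²/4))`, giving an element of `SU(2)` of trace `s`.
    have h : Complex.normSq (s / 2 : ℝ) + Complex.normSq (√(1 - (s / 2) ^ 2) : ℝ) = 1 := by
      rw [Complex.normSq_ofReal, Complex.normSq_ofReal, Real.mul_self_sqrt (by nlinarith)]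
      ring
    have htr : (inclSU2 (mkSU2 _ _ h)).1.trace = (s : ℂ) := by
      simp only [inclSU2_val, mkSU2, trace_fin_two_of, Complex.conj_ofReal]
      push_cast
      ring
    refine ⟨cyclicRep m n (mkSU2 _ _ h), ?_, ?_⟩
    · rw [comp_cyclicRep]
      exact not_isIrred_cyclicRep _
    · rw [comp_cyclicRep, character_cyclicRep, htr]
  · rintro ⟨ρ, hρ, rfl⟩
    obtain ⟨z, hz⟩ := exists_redLine_eq hmn hρ
    -- The parameter on the line is the character value at `genZ`, so it is the trace of an element
    -- of `SU(2)`.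
    obtain ⟨r, hr, hr'⟩ := exists_real_trace (ρ (genZ m n))
    refine ⟨r, hr, ?_⟩
    rw [← hz]
    have h := redLine_genZ hmn z
    rw [hz] at h
    exact congrArg _ (hr'.symm.trans h)

theorem character_eq_redLine {t : ℂ} {ρ : KnotGroup m n →* SL2C} (ht : t ≠ 0)
    (hx : (ρ (genX m n)).1 = !![t ^ n, 0; 0, (t ^ n)⁻¹])
    (hy : (ρ (genY m n)).1 = !![t ^ m, 0; 0, (t ^ m)⁻¹]) :
    character ρ = redLine m n (t + t⁻¹) := by
  refine HasLineTraces.eq (t := t) ⟨?_, ?_, ?_⟩ (hasLineTraces_redLine ht)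
  · simp [character, hx, trace_fin_two]
  · simp [character, hy, trace_fin_two]
  · rw [character_genX_mul_genY, hx, hy]
    simp [trace_fin_two, mul_comm]

end Reducible

/-! ### The lines of irreducible characters -/

section Arc

variable {m n : ℕ}

theorem HasArcTraces.eq {q : ℕ × ℕ} {u : ℂ} {ρ σ : KnotGroup m n →* SL2C}
    (hρ : HasArcTraces q u (character ρ)) (hσ : HasArcTraces q u (character σ)) :
    character ρ = character σ :=
  character_ext (hρ.1.trans hσ.1.symm) (hρ.2.1.trans hσ.2.1.symm) (hρ.2.2.trans hσ.2.2.symm)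

/-- A representation with the traces prescribed by the point `u` of the line of index `q`. -/
def arcRep (q : {q // q ∈ indexPairs m n}) (u : ℂ) : KnotGroup m n →* SL2C :=
  (exists_rep_hasArcTraces q.2 u).choose

/-- The line that contains the irreducible characters of index `q`. -/
def arcLine (q : {q // q ∈ indexPairs m n}) (u : ℂ) : KnotGroup m n → ℂ :=
  character (arcRep q u)

theorem hasArcTraces_arcLine (q : {q // q ∈ indexPairs m n}) (u : ℂ) :
    HasArcTraces q.1 u (arcLine q u) :=
  (exists_rep_hasArcTraces q.2 u).choose_spec

theorem arcLine_isComplexLine (q : {q // q ∈ indexPairs m n}) : IsComplexLine (arcLine q) := by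
  constructor
  · intro g
    obtain ⟨P, hP⟩ := exists_universal_polynomial g
    refine ⟨MvPolynomial.aeval ![Polynomial.C (eig q.1.1 m + (eig q.1.1 m)⁻¹),
      Polynomial.C (eig q.1.2 n + (eig q.1.2 n)⁻¹),
      Polynomial.C (arcTrace m n q.1 0) - Polynomial.C ((eig q.1.1 m - (eig q.1.1 m)⁻¹) *
        (eig q.1.2 n - (eig q.1.2 n)⁻¹)) * Polynomial.X] P, fun z => ?_⟩
    obtain ⟨h1, h2, h3⟩ := hasArcTraces_arcLine q z
    rw [arcLine] at *
    rw [hP, h1, h2, h3, arcTrace_eq, ← Polynomial.coe_evalRingHom, MvPolynomial.aeval_def,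
      MvPolynomial.hom_eval₂, MvPolynomial.eval, MvPolynomial.coe_eval₂Hom]
    congr 1
    · ext; simp
    · ext i; fin_cases i <;> simp
  · refine ⟨MvPolynomial.C (((eig q.1.1 m - (eig q.1.1 m)⁻¹) *
      (eig q.1.2 n - (eig q.1.2 n)⁻¹))⁻¹) * (MvPolynomial.C (arcTrace m n q.1 0) -
        MvPolynomial.X (genX m n * genY m n)), fun z => ?_⟩
    rw [map_mul, map_sub, MvPolynomial.eval_C, MvPolynomial.eval_C, MvPolynomial.eval_X,
      (hasArcTraces_arcLine q z).2.2, arcTrace_eq m n q.1 z, sub_sub_cancel,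
      inv_mul_cancel_left₀ (arc_slope_ne_zero q.2)]

theorem arcLine_image_compl (q : {q // q ∈ indexPairs m n}) :
    arcLine q '' {0, 1}ᶜ = XirrComp m n q.1 := by
  ext χ
  constructor
  · rintro ⟨u, hu, rfl⟩
    have h := hasArcTraces_arcLine q u
    exact ⟨arcRep q u, (isIrred_iff _).mpr ((h.kappa_ne_zero_iff q.2).mpr hu),
      hasEigs_iff.mpr ⟨h.1, h.2.1⟩, rfl⟩
  · rintro ⟨ρ, hρ, hq, rfl⟩
    obtain ⟨h1, h2⟩ := hasEigs_iff.mp hq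
    obtain ⟨u, hu⟩ := exists_hasArcTraces q.2 h1 h2
    exact ⟨u, (hu.kappa_ne_zero_iff q.2).mp ((isIrred_iff _).mp hρ),
      (hasArcTraces_arcLine q u).eq hu⟩

theorem arcLine_zero (q : {q // q ∈ indexPairs m n}) {t : ℂ} (h1 : t ^ n = eig q.1.1 m)
    (h2 : t ^ m = eig q.1.2 n) (ht : t ≠ 0) : arcLine q 0 = redLine m n (t + t⁻¹) := by
  refine HasLineTraces.eq (t := t) ?_ (hasLineTraces_redLine ht)
  obtain ⟨e1, e2, e3⟩ := hasArcTraces_arcLine q 0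
  refine ⟨by rw [h1]; exact e1, by rw [h2]; exact e2, ?_⟩
  rw [h1, h2]
  refine e3.trans ?_
  rw [arcTrace]
  ring

theorem arcLine_one (q : {q // q ∈ indexPairs m n}) {t : ℂ} (h1 : t ^ n = eig q.1.1 m)
    (h2 : t ^ m = (eig q.1.2 n)⁻¹) (ht : t ≠ 0) : arcLine q 1 = redLine m n (t + t⁻¹) := by
  refine HasLineTraces.eq (t := t) ?_ (hasLineTraces_redLine ht)
  obtain ⟨e1, e2, e3⟩ := hasArcTraces_arcLine q 1
  refine ⟨by rw [h1]; exact e1, by rw [h2, inv_inv, add_comm]; exact e2, ?_⟩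
  rw [h1, h2]
  refine e3.trans ?_
  rw [arcTrace]
  ring

/-- On the unit interval the line of index `q` consists of characters of `SU(2)`. -/
theorem exists_su2_hasArcTraces {q : ℕ × ℕ} (hq : q ∈ indexPairs m n) {u : ℝ}
    (hu : u ∈ Set.Icc (0 : ℝ) 1) :
    ∃ ρ : KnotGroup m n →* SU2, HasArcTraces q u (character (inclSU2.comp ρ)) := by
  have hc' := eig_inv q.1 m
  have hd' := eig_inv q.2 n
  have hcn := norm_eig q.1 m
  have hdn := norm_eig q.2 n
  set c := eig q.1 m with hc
  set d := eig q.2 n with hd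
  -- A convex combination of two points of the unit circle has norm at most one, so it is a diagonal
  -- entry of some element of `SU(2)`; its conjugate is the opposite combination.
  set w : ℂ := (1 - u) * d + u * d⁻¹ with hw
  have hwn : ‖w‖ ≤ 1 := by
    calc ‖w‖ ≤ ‖((1 - u : ℝ) : ℂ) * d‖ + ‖(u : ℂ) * d⁻¹‖ := by
          rw [hw, Complex.ofReal_sub, Complex.ofReal_one]; exact norm_add_le _ _
      _ = 1 := by
          rw [norm_mul, norm_mul, norm_inv, hdn, Complex.norm_real, Complex.norm_real,
            Real.norm_of_nonneg hu.1, Real.norm_of_nonneg (sub_nonneg.mpr hu.2)]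
          norm_num
  have hw2 : Complex.normSq w + Complex.normSq (√(1 - Complex.normSq w) : ℝ) = 1 := by
    have : Complex.normSq w ≤ 1 := by
      rw [Complex.normSq_eq_norm_sq]
      exact pow_le_one₀ (norm_nonneg _) hwn
    rw [Complex.normSq_ofReal, Real.mul_self_sqrt (by linarith)]
    ring
  have hc2 : Complex.normSq c + Complex.normSq 0 = 1 := by
    rw [Complex.normSq_eq_norm_sq, hcn, map_zero]
    norm_num
  have hwc : (starRingEnd ℂ) w = (1 - u) * d⁻¹ + u * d := by
    rw [hw, hd']
    simp
  let A : SU2 := mkSU2 c 0 hc2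
  let B : SU2 := mkSU2 w _ hw2
  have hA : A.1.trace = c + c⁻¹ := by simp [A, mkSU2, trace_fin_two, hc']
  have hB : B.1.trace = d + d⁻¹ := by
    simp only [B, mkSU2, trace_fin_two_of, hwc]
    rw [hw]
    ring
  have h : A ^ m = B ^ n := Subtype.ext
    (pow_eq_pow_of_traces hq (mem_specialUnitaryGroup_iff.mp A.2).2
      (mem_specialUnitaryGroup_iff.mp B.2).2 hA hB)
  refine ⟨lift A B h, ?_, ?_, ?_⟩
  · rw [character, MonoidHom.comp_apply, lift_genX, inclSU2_val, hA]
  · rw [character, MonoidHom.comp_apply, lift_genY, inclSU2_val, hB]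
  · rw [character_genX_mul_genY, MonoidHom.comp_apply, MonoidHom.comp_apply, lift_genX,
      lift_genY, inclSU2_val, inclSU2_val, arcTrace, ← hc, ← hd]
    simp only [A, B, mkSU2, trace_fin_two, Matrix.mul_apply, Fin.sum_univ_two, of_apply, cons_val',
      cons_val_zero, cons_val_one, cons_val_fin_one, hwc, ← hc', map_zero, neg_zero]
    rw [hw]
    simp only [mul_inv, inv_inv]
    ring

theorem arcTrace_eq_real (m n : ℕ) (q : ℕ × ℕ) (u : ℂ) : arcTrace m n q u =
    (2 * (eig q.1 m * eig q.2 n).re : ℝ)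
      + (4 * ((eig q.1 m).im * (eig q.2 n).im) : ℝ) * u := by
  rw [arcTrace_eq, eig_sub_inv, eig_sub_inv]
  have : arcTrace m n q 0 = (2 * (eig q.1 m * eig q.2 n).re : ℝ) := by
    rw [← Complex.add_conj, map_mul, ← eig_inv, ← eig_inv, arcTrace, mul_inv]
    ring
  rw [this]
  push_cast
  linear_combination (-4 * ((eig q.1 m).im : ℂ) * (eig q.2 n).im * u) * Complex.I_mul_I

theorem arcLine_image_Ioo (q : {q // q ∈ indexPairs m n}) :
    (fun u : ℝ => arcLine q (u : ℂ)) '' Set.Ioo 0 1 = YirrComp m n q.1 := by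
  obtain ⟨⟨hk, hkm⟩, ⟨hl, hln⟩, -⟩ := mem_indexPairs.mp q.2
  have hs := mul_pos (eig_im_pos hk hkm) (eig_im_pos hl hln)
  ext χ
  constructor
  · rintro ⟨u, hu, rfl⟩
    obtain ⟨ρ, hρ⟩ := exists_su2_hasArcTraces q.2 (Set.Ioo_subset_Icc_self hu)
    refine ⟨ρ, (isIrred_iff _).mpr ((hρ.kappa_ne_zero_iff q.2).mpr ?_),
      hasEigs_iff.mpr ⟨hρ.1, hρ.2.1⟩, (hasArcTraces_arcLine q u).eq hρ⟩
    simp only [Set.mem_compl_iff, Set.mem_insert_iff, Set.mem_singleton_iff, not_or]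
    exact ⟨by exact_mod_cast hu.1.ne', by exact_mod_cast hu.2.ne⟩
  · rintro ⟨ρ, hρ, hq, rfl⟩
    obtain ⟨h1, h2⟩ := hasEigs_iff.mp hq
    obtain ⟨u, hu⟩ := exists_hasArcTraces q.2 h1 h2
    -- Reality of the trace at `x y` makes `u` real; the bound `2` on the commutator trace then
    -- gives `u (1 - u) ≥ 0`, with equality excluded by irreducibility.
    obtain ⟨r, -, hr⟩ := exists_real_trace (ρ (genX m n * genY m n))
    obtain ⟨r', hr2, hr'⟩ :=
      exists_real_trace (ρ (genX m n * genY m n * (genX m n)⁻¹ * (genY m n)⁻¹))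
    set s := (eig q.1.1 m).im * (eig q.1.2 n).im with hs'
    have hur : u = ((r - 2 * (eig q.1.1 m * eig q.1.2 n).re) / (4 * s) : ℝ) := by
      have h := hr.symm.trans hu.2.2
      rw [arcTrace_eq_real, ← hs'] at h
      have hs0 : (s : ℂ) ≠ 0 := Complex.ofReal_ne_zero.mpr hs.ne'
      push_cast at h ⊢
      rw [h]
      field_simp
      ring
    set v := (r - 2 * (eig q.1.1 m * eig q.1.2 n).re) / (4 * s) with hv
    refine ⟨v, ?_, (hasArcTraces_arcLine q v).eq (hur ▸ hu)⟩
    have hne := (isIrred_iff _).mp hρ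
    have hcomm := character_commutator (inclSU2.comp ρ)
    rw [hu.kappa_eq, hur] at hcomm hne
    have hkap : (r' : ℂ) = ((-16 * s ^ 2 * (v * (1 - v)) + 2 : ℝ) : ℂ) := by
      refine hr'.symm.trans (hcomm.trans ?_)
      rw [eig_sub_inv, eig_sub_inv, hs']
      push_cast
      linear_combination (-16 * ((eig q.1.1 m).im : ℂ) ^ 2 * (eig q.1.2 n).im ^ 2 * v * (1 - v)) *
        (Complex.I * Complex.I - 1) * Complex.I_mul_I
    have hkap' : r' = -16 * s ^ 2 * (v * (1 - v)) + 2 := Complex.ofReal_injective hkap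
    have hv0 : v * (1 - v) ≠ 0 := by
      intro h0
      refine hne ?_
      have : (v : ℂ) * (1 - v) = 0 := by exact_mod_cast h0
      rw [this, mul_zero]
    have hge : 0 ≤ v * (1 - v) := by
      have h16 : 0 ≤ 16 * s ^ 2 * (v * (1 - v)) := by linarith [hr2.2]
      exact nonneg_of_mul_nonneg_right h16 (by positivity)
    have hpos := lt_of_le_of_ne hge hv0.symm
    constructor <;> nlinarith

end Arc

end Matrices

/-! ### Topology -/

/-- The image of a component under `f` is connected and finite, hence a single point, so the
component cannot leave its piece. -/
theorem connectedComponentIn_eq_of_separating {α β ι : Type*} [TopologicalSpace α]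
    [TopologicalSpace β] [T1Space β] {S : Set α} {K : Finset ι} {C : ι → Set α}
    (hU : ⋃ q ∈ K, C q = S) (hC : ∀ q ∈ K, IsPreconnected (C q)) {f : α → β}
    (hf : Continuous f) {c : ι → β} (hfc : ∀ q ∈ K, ∀ a ∈ C q, f a = c q)
    (hc : Set.InjOn c K) {q : ι} (hq : q ∈ K) {a : α} (ha : a ∈ C q) :
    connectedComponentIn S a = C q := by
  have hsub : C q ⊆ S := hU ▸ Set.subset_biUnion_of_mem (u := C) hq
  refine Set.Subset.antisymm ?_ ((hC q hq).subset_connectedComponentIn ha hsub)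
  have hfin : (f '' connectedComponentIn S a).Finite := by
    refine (K.finite_toSet.image c).subset ?_
    rintro _ ⟨b, hb, rfl⟩
    have hbS := connectedComponentIn_subset S a hb
    rw [← hU] at hbS
    obtain ⟨r, hr, hbr⟩ := Set.mem_iUnion₂.mp hbS
    exact ⟨r, hr, (hfc r hr b hbr).symm⟩
  have hsing : (f '' connectedComponentIn S a).Subsingleton := by
    by_contra h
    exact (isPreconnected_connectedComponentIn.image f hf.continuousOn).infinite_of_nontrivial
      (Set.not_subsingleton_iff.mp h) hfin
  intro b hb
  have hbS := connectedComponentIn_subset S a hb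
  rw [← hU] at hbS
  obtain ⟨r, hr, hbr⟩ := Set.mem_iUnion₂.mp hbS
  have hab : f b = f a := hsing (Set.mem_image_of_mem f hb)
    (Set.mem_image_of_mem f (mem_connectedComponentIn (hsub ha)))
  rw [hfc r hr b hbr, hfc q hq a ha] at hab
  rwa [← hc hr hq hab]

/-- A compact space with intervals attached is homeomorphic to any Hausdorff space that is
the union of an embedded copy of it and of arcs which are disjoint outside their ends. -/
theorem exists_homeomorph_attach {ι B Z : Type*} [Finite ι] [TopologicalSpace ι]
    [DiscreteTopology ι] [TopologicalSpace B] [CompactSpace B] [TopologicalSpace Z] [T2Space Z]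
    (p : ι × Bool → B) (f : B → Z) (g : ι → unitInterval → Z) (hf : Continuous f)
    (hg : ∀ i, Continuous (g i)) (h0 : ∀ i, g i 0 = f (p (i, false)))
    (h1 : ∀ i, g i 1 = f (p (i, true))) (hfi : Function.Injective f)
    (hgi : ∀ i j u v, u ≠ 0 → u ≠ 1 → g i u = g j v → i = j ∧ u = v)
    (hfg : ∀ i u b, u ≠ 0 → u ≠ 1 → g i u ≠ f b)
    (hsurj : ∀ z, (∃ b, f b = z) ∨ ∃ i u, g i u = z) :
    ∃ h : Attach p ≃ₜ Z, (∀ b, h (Attach.base p b) = f b) ∧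
      ∀ i u, h (Attach.arc p i u) = g i u := by
  have hresp : ∀ a b, AttachRel p a b →
      Sum.elim f (fun x : ι × unitInterval => g x.1 x.2) a
        = Sum.elim f (fun x : ι × unitInterval => g x.1 x.2) b := by
    rintro _ _ (i | i)
    · exact h0 i
    · exact h1 i
  let F : Attach p → Z := Quot.lift _ hresp
  have hbase (b : B) : F (Attach.base p b) = f b := rfl
  have harc (i : ι) (u : unitInterval) : F (Attach.arc p i u) = g i u := rfl
  have hF : Continuous F := by
    exact continuous_quot_lift hresp (hf.sumElim (continuous_prod_of_discrete_left.mpr hg))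
  -- Normal form: every class is represented by a base point or by an interior point of an arc.
  have hcases (x : Attach p) : (∃ b, x = Attach.base p b) ∨
      ∃ i u, u ≠ 0 ∧ u ≠ 1 ∧ x = Attach.arc p i u := by
    obtain ⟨b | ⟨i, u⟩, rfl⟩ := Quot.exists_rep x
    · exact Or.inl ⟨b, rfl⟩
    · by_cases hu0 : u = 0
      · subst hu0
        exact Or.inl ⟨_, Quot.sound (AttachRel.left i)⟩
      · by_cases hu1 : u = 1
        · subst hu1
          exact Or.inl ⟨_, Quot.sound (AttachRel.right i)⟩
        · exact Or.inr ⟨i, u, hu0, hu1, rfl⟩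
  have hinj : Function.Injective F := by
    intro x y hxy
    rcases hcases x with ⟨b, rfl⟩ | ⟨i, u, hu0, hu1, rfl⟩ <;>
      rcases hcases y with ⟨b', rfl⟩ | ⟨j, v, hv0, hv1, rfl⟩
    · rw [hbase, hbase] at hxy
      rw [hfi hxy]
    · exact absurd hxy.symm (hfg j v b hv0 hv1)
    · exact absurd hxy (hfg i u b' hu0 hu1)
    · obtain ⟨rfl, rfl⟩ := hgi i j u v hu0 hu1 hxy
      rfl
  have hsur : Function.Surjective F := by
    intro z
    rcases hsurj z with ⟨b, rfl⟩ | ⟨i, u, rfl⟩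
    · exact ⟨Attach.base p b, rfl⟩
    · exact ⟨Attach.arc p i u, rfl⟩
  have : CompactSpace (Attach p) := Quot.compactSpace
  let E : Attach p ≃ Z := Equiv.ofBijective F ⟨hinj, hsur⟩
  exact ⟨Continuous.homeoOfEquivCompactToT2 (f := E) hF, hbase, harc⟩

theorem IsComplexLine.continuous {G : Type*} [Group G] {ψ : ℂ → G → ℂ} (h : IsComplexLine ψ) :
    Continuous ψ := by
  refine continuous_pi fun g => ?_
  obtain ⟨P, hP⟩ := h.1 g
  simp only [hP]
  exact P.continuous

theorem IsComplexLine.injective {G : Type*} [Group G] {ψ : ℂ → G → ℂ} (h : IsComplexLine ψ) :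
    Function.Injective ψ := by
  obtain ⟨Q, hQ⟩ := h.2
  intro z w hzw
  rw [← hQ z, ← hQ w, hzw]

/-! ### The structure of the character varieties -/

section Main

variable {m n : ℕ}

theorem kappa_ne_zero_of_mem_Xirr {χ : KnotGroup m n → ℂ} (h : χ ∈ Xirr (KnotGroup m n)) :
    kappa χ ≠ 0 := by
  obtain ⟨ρ, hρ, rfl⟩ := h
  exact (isIrred_iff ρ).mp hρ

theorem kappa_eq_zero_of_mem_Xred {χ : KnotGroup m n → ℂ} (h : χ ∈ Xred (KnotGroup m n)) :
    kappa χ = 0 := by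
  obtain ⟨ρ, hρ, rfl⟩ := h
  by_contra hne
  exact hρ ((isIrred_iff ρ).mpr hne)

theorem Yred_subset_Xred : Yred (KnotGroup m n) ⊆ Xred (KnotGroup m n) := by
  rintro _ ⟨ρ, hρ, rfl⟩
  exact ⟨_, hρ, rfl⟩

theorem Y_subset_X : Y (KnotGroup m n) ⊆ X (KnotGroup m n) := by
  rintro _ ⟨ρ, rfl⟩
  exact ⟨_, rfl⟩

theorem Yred_union_Yirr : Yred (KnotGroup m n) ∪ Yirr (KnotGroup m n) = Y (KnotGroup m n) := by
  ext χ
  constructor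
  · rintro (⟨ρ, -, rfl⟩ | ⟨ρ, -, rfl⟩) <;> exact ⟨ρ, rfl⟩
  · rintro ⟨ρ, rfl⟩
    by_cases h : IsIrred (inclSU2.comp ρ)
    · exact Or.inr ⟨ρ, h, rfl⟩
    · exact Or.inl ⟨ρ, h, rfl⟩

theorem disjoint_Xred_Xirr : Disjoint (Xred (KnotGroup m n)) (Xirr (KnotGroup m n)) :=
  Set.disjoint_left.mpr fun _ h1 h2 =>
    kappa_ne_zero_of_mem_Xirr h2 (kappa_eq_zero_of_mem_Xred h1)

theorem iUnion_XirrComp (hm : 0 < m) (hn : 0 < n) :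
    (⋃ q ∈ indexPairs m n, XirrComp m n q) = Xirr (KnotGroup m n) := by
  ext χ
  rw [Set.mem_iUnion₂]
  constructor
  · rintro ⟨q, -, ρ, hρ, -, rfl⟩
    exact ⟨ρ, hρ, rfl⟩
  · rintro ⟨ρ, hρ, rfl⟩
    obtain ⟨q, hq, h⟩ := exists_traces_of_isIrred hm hn hρ
    exact ⟨q, hq, ρ, hρ, hasEigs_iff.mpr h, rfl⟩

theorem iUnion_YirrComp (hm : 0 < m) (hn : 0 < n) :
    (⋃ q ∈ indexPairs m n, YirrComp m n q) = Yirr (KnotGroup m n) := by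
  ext χ
  rw [Set.mem_iUnion₂]
  constructor
  · rintro ⟨q, -, ρ, hρ, -, rfl⟩
    exact ⟨ρ, hρ, rfl⟩
  · rintro ⟨ρ, hρ, rfl⟩
    obtain ⟨q, hq, h⟩ := exists_traces_of_isIrred hm hn hρ
    exact ⟨q, hq, ρ, hρ, hasEigs_iff.mpr h, rfl⟩

/-- The values of a function on the torus knot group at the two generators. -/
def genValues (χ : KnotGroup m n → ℂ) : ℂ × ℂ := (χ (genX m n), χ (genY m n))

theorem continuous_genValues : Continuous (genValues (m := m) (n := n)) :=
  (continuous_apply _).prodMk (continuous_apply _)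

/-- The traces of the generators that are prescribed by `q`. -/
def eigTraces (m n : ℕ) (q : ℕ × ℕ) : ℂ × ℂ :=
  (eig q.1 m + (eig q.1 m)⁻¹, eig q.2 n + (eig q.2 n)⁻¹)

theorem eigTraces_injOn : Set.InjOn (eigTraces m n) (indexPairs m n) := by
  intro q hq q' hq' h
  obtain ⟨⟨h1, h2⟩, ⟨h3, h4⟩, -⟩ := mem_indexPairs.mp hq
  obtain ⟨⟨h1', h2'⟩, ⟨h3', h4'⟩, -⟩ := mem_indexPairs.mp hq'
  exact Prod.ext (eig_add_inv_injOn h1 h2 h1' h2' (congrArg Prod.fst h))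
    (eig_add_inv_injOn h3 h4 h3' h4' (congrArg Prod.snd h))

theorem YirrComp_subset_XirrComp (q : ℕ × ℕ) : YirrComp m n q ⊆ XirrComp m n q := by
  rintro _ ⟨ρ, hρ, hq, rfl⟩
  exact ⟨_, hρ, hq, rfl⟩

theorem genValues_of_mem_XirrComp {q : ℕ × ℕ} {χ : KnotGroup m n → ℂ}
    (h : χ ∈ XirrComp m n q) : genValues χ = eigTraces m n q := by
  obtain ⟨ρ, -, hq, rfl⟩ := h
  obtain ⟨h1, h2⟩ := hasEigs_iff.mp hq
  exact Prod.ext h1 h2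

/-- Prescribed traces at the generators are a closed condition; this is why even the closures of the
pieces are disjoint. -/
theorem genValues_of_mem_closure_YirrComp {q : ℕ × ℕ} {χ : KnotGroup m n → ℂ}
    (h : χ ∈ closure (YirrComp m n q)) : genValues χ = eigTraces m n q := by
  have hcl : IsClosed {χ : KnotGroup m n → ℂ | genValues χ = eigTraces m n q} :=
    isClosed_eq continuous_genValues continuous_const
  exact closure_minimal (fun χ hχ => genValues_of_mem_XirrComp (YirrComp_subset_XirrComp q hχ))
    hcl h

/-- Irreducibility and the eigenvalues at the generators depend only on the character, so they pass
between representations that share it. -/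
theorem YirrComp_eq_inter (q : ℕ × ℕ) :
    YirrComp m n q = Y (KnotGroup m n) ∩ XirrComp m n q := by
  ext χ
  constructor
  · intro h
    refine ⟨?_, YirrComp_subset_XirrComp q h⟩
    obtain ⟨ρ, -, -, rfl⟩ := h
    exact ⟨ρ, rfl⟩
  · rintro ⟨⟨ρ, rfl⟩, σ, hσ, hq, h⟩
    refine ⟨ρ, ?_, ?_, rfl⟩
    · rw [isIrred_iff, h, ← isIrred_iff]
      exact hσ
    · rw [hasEigs_iff, h, ← hasEigs_iff]
      exact hq

theorem isPreconnected_XirrComp {q : ℕ × ℕ} (hq : q ∈ indexPairs m n) :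
    IsPreconnected (XirrComp m n q) := by
  rw [← arcLine_image_compl ⟨q, hq⟩]
  refine IsPreconnected.image ?_ _ (arcLine_isComplexLine _).continuous.continuousOn
  -- The complement of a countable set in a space of real dimension above one is connected.
  exact ((Set.toFinite ({0, 1} : Set ℂ)).countable.isConnected_compl_of_one_lt_rank
    (by rw [Complex.rank_real_complex]; exact Cardinal.one_lt_two)).isPreconnected

theorem continuous_arcLine_real (q : {q // q ∈ indexPairs m n}) :
    Continuous fun u : ℝ => arcLine q (u : ℂ) :=
  (arcLine_isComplexLine q).continuous.comp Complex.continuous_ofReal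

theorem isPreconnected_YirrComp {q : ℕ × ℕ} (hq : q ∈ indexPairs m n) :
    IsPreconnected (YirrComp m n q) := by
  rw [← arcLine_image_Ioo ⟨q, hq⟩]
  exact isPreconnected_Ioo.image _ (continuous_arcLine_real _).continuousOn

theorem closure_YirrComp (q : {q // q ∈ indexPairs m n}) :
    closure (YirrComp m n q.1) = (fun u : ℝ => arcLine q (u : ℂ)) '' Set.Icc 0 1 := by
  rw [← arcLine_image_Ioo q]
  have h := image_closure_of_isCompact (s := Set.Ioo (0 : ℝ) 1)
    (by rw [closure_Ioo zero_ne_one]; exact isCompact_Icc)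
    (continuous_arcLine_real q).continuousOn
  rw [← h, closure_Ioo zero_ne_one]

theorem disjoint_closure_YirrComp {q q' : ℕ × ℕ} (hq : q ∈ indexPairs m n)
    (hq' : q' ∈ indexPairs m n) (hne : q ≠ q') :
    Disjoint (closure (YirrComp m n q)) (closure (YirrComp m n q')) :=
  Set.disjoint_left.mpr fun _ h h' => hne (eigTraces_injOn hq hq'
    ((genValues_of_mem_closure_YirrComp h).symm.trans (genValues_of_mem_closure_YirrComp h')))

theorem disjoint_XirrComp {q q' : ℕ × ℕ} (hq : q ∈ indexPairs m n)
    (hq' : q' ∈ indexPairs m n) (hne : q ≠ q') :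
    Disjoint (XirrComp m n q) (XirrComp m n q') :=
  Set.disjoint_left.mpr fun _ h h' => hne (eigTraces_injOn hq hq'
    ((genValues_of_mem_XirrComp h).symm.trans (genValues_of_mem_XirrComp h')))

/-! ### The points of attachment and the homeomorphism -/

/-- The eigenvalue `μ` or its inverse, according to the end of the interval. -/
def endEig (n : ℕ) (k : ℕ) (b : Bool) : ℂ := if b then (eig k n)⁻¹ else eig k n

theorem exists_end (hmn : Nat.Coprime m n) (q : {q // q ∈ indexPairs m n}) (b : Bool) :
    ∃ s : Set.Icc (-2 : ℝ) 2, ∃ t : ℂ, t ^ n = eig q.1.1 m ∧ t ^ m = endEig n q.1.2 b ∧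
      ((s : ℝ) : ℂ) = t + t⁻¹ := by
  obtain ⟨⟨hk, hkm⟩, ⟨hl, hln⟩, -⟩ := mem_indexPairs.mp q.2
  have hb0 : endEig n q.1.2 b ≠ 0 := by
    cases b
    · exact eig_ne_zero _ _
    · exact inv_ne_zero (eig_ne_zero _ _)
  have hpow : eig q.1.1 m ^ m = endEig n q.1.2 b ^ n := by
    rw [eig_pow_eq_eig_pow q.2]
    cases b
    · rfl
    · change _ = (eig q.1.2 n)⁻¹ ^ n
      rw [inv_pow, eig_pow_inv (hl.trans hln)]
  obtain ⟨t, ht0, ht1, ht2⟩ := exists_pow_eq_of_coprime hmn (eig_ne_zero _ _) hb0 hpow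
  -- `t ^ n` lies on the unit circle, hence so does `t`, and `t + t⁻¹ = 2 Re t` lies in `[-2, 2]`.
  have hnorm : ‖t‖ = 1 := by
    have h := congrArg norm ht1
    rw [norm_pow, norm_eig] at h
    exact (pow_eq_one_iff_of_nonneg (norm_nonneg _) (hl.trans hln).ne').mp h
  have habs := abs_le.mp ((Complex.abs_re_le_norm t).trans hnorm.le)
  refine ⟨⟨2 * t.re, by linarith [habs.1], by linarith [habs.2]⟩, t, ht1, ht2, ?_⟩
  rw [Complex.inv_eq_conj hnorm, Complex.add_conj]

/-- The points of `[-2, 2]` at which the intervals are attached. -/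
def endPoint (hmn : Nat.Coprime m n) (x : {q // q ∈ indexPairs m n} × Bool) :
    Set.Icc (-2 : ℝ) 2 :=
  (exists_end hmn x.1 x.2).choose

theorem endPoint_spec (hmn : Nat.Coprime m n) (q : {q // q ∈ indexPairs m n}) (b : Bool) :
    ∃ t : ℂ, t ^ n = eig q.1.1 m ∧ t ^ m = endEig n q.1.2 b ∧
      ((endPoint hmn (q, b) : ℝ) : ℂ) = t + t⁻¹ :=
  (exists_end hmn q b).choose_spec

theorem ne_zero_of_pow_eq_eig {q : ℕ × ℕ} (hq : q ∈ indexPairs m n) {t : ℂ}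
    (h : t ^ n = eig q.1 m) : t ≠ 0 := by
  obtain ⟨-, ⟨hl, hln⟩, -⟩ := mem_indexPairs.mp hq
  rintro rfl
  rw [zero_pow (hl.trans hln).ne'] at h
  exact eig_ne_zero _ _ h.symm

/-- The point determines `t` up to inversion, and `Im t ^ n > 0` fixes `t`. Then `t ^ n` gives `k`,
the sign of `Im t ^ m` tells which end it is, and `t ^ m` gives `k'`. -/
theorem endPoint_injective (hmn : Nat.Coprime m n) : Function.Injective (endPoint hmn) := by
  rintro ⟨q, b⟩ ⟨q', b'⟩ h
  obtain ⟨t, ht1, ht2, ht⟩ := endPoint_spec hmn q b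
  obtain ⟨t', ht1', ht2', ht'⟩ := endPoint_spec hmn q' b'
  obtain ⟨⟨hk, hkm⟩, ⟨hl, hln⟩, -⟩ := mem_indexPairs.mp q.2
  obtain ⟨⟨hk', hkm'⟩, ⟨hl', hln'⟩, -⟩ := mem_indexPairs.mp q'.2
  rw [h, ht'] at ht
  have hk_im := eig_im_pos hk hkm
  have hk_im' := eig_im_pos hk' hkm'
  have hl_im := eig_im_pos hl hln
  have hl_im' := eig_im_pos hl' hln'
  rcases (add_inv_eq_add_inv_iff (ne_zero_of_pow_eq_eig q'.2 ht1')
    (ne_zero_of_pow_eq_eig q.2 ht1)).mp ht with rfl | rfl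
  · have e1 : q.1.1 = q'.1.1 := eig_injOn hkm hkm' (ht1.symm.trans ht1')
    have e := ht2.symm.trans ht2'
    have e2 : b = b' ∧ eig q.1.2 n = eig q'.1.2 n := by
      cases b <;> cases b' <;> simp only [endEig, if_true, Bool.false_eq_true, if_false] at e
      · exact ⟨rfl, e⟩
      · rw [e, eig_inv, Complex.conj_im] at hl_im
        linarith
      · rw [← e, eig_inv, Complex.conj_im] at hl_im'
        linarith
      · exact ⟨rfl, inv_injective e⟩
    exact Prod.ext (Subtype.ext (Prod.ext e1 (eig_injOn hln hln' e2.2))) e2.1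
  · rw [← ht1', inv_pow, ht1, eig_inv, Complex.conj_im] at hk_im'
    linarith

theorem arcLine_zero_eq (hmn : Nat.Coprime m n) (q : {q // q ∈ indexPairs m n}) :
    arcLine q 0 = redLine m n (endPoint hmn (q, false) : ℝ) := by
  obtain ⟨t, h1, h2, h⟩ := endPoint_spec hmn q false
  rw [h, arcLine_zero q h1 h2 (ne_zero_of_pow_eq_eig q.2 h1)]

theorem arcLine_one_eq (hmn : Nat.Coprime m n) (q : {q // q ∈ indexPairs m n}) :
    arcLine q 1 = redLine m n (endPoint hmn (q, true) : ℝ) := by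
  obtain ⟨t, h1, h2, h⟩ := endPoint_spec hmn q true
  rw [h, arcLine_one q h1 h2 (ne_zero_of_pow_eq_eig q.2 h1)]

theorem redLine_mem_Yred (hmn : Nat.Coprime m n) (s : Set.Icc (-2 : ℝ) 2) :
    redLine m n (s : ℝ) ∈ Yred (KnotGroup m n) := by
  rw [← redLine_image_Icc hmn]
  exact ⟨s, s.2, rfl⟩

theorem kappa_arcLine_ne_zero (q : {q // q ∈ indexPairs m n}) {u : ℝ} (h0 : u ≠ 0)
    (h1 : u ≠ 1) : kappa (arcLine q u) ≠ 0 := by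
  rw [(hasArcTraces_arcLine q u).kappa_ne_zero_iff q.2]
  simp only [Set.mem_compl_iff, Set.mem_insert_iff, Set.mem_singleton_iff, not_or]
  exact ⟨by exact_mod_cast h0, by exact_mod_cast h1⟩

/-- The closure is the finite union of the closed arcs, and on each arc `kappa`, which vanishes on
reducible characters, is zero only at the two ends. -/
theorem closure_Yirr_inter_Yred (hm : 0 < m) (hn : 0 < n) (hmn : Nat.Coprime m n) :
    closure (Yirr (KnotGroup m n)) ∩ Yred (KnotGroup m n)
      = Set.range fun x => redLine m n (endPoint hmn x : ℝ) := by
  have hcl : closure (Yirr (KnotGroup m n))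
      = ⋃ q ∈ indexPairs m n, closure (YirrComp m n q) := by
    rw [← iUnion_YirrComp hm hn, Finset.closure_biUnion]
  ext χ
  constructor
  · rintro ⟨h, hred⟩
    rw [hcl, Set.mem_iUnion₂] at h
    obtain ⟨q, hq, h⟩ := h
    rw [closure_YirrComp ⟨q, hq⟩] at h
    obtain ⟨u, -, rfl⟩ := h
    have hk := kappa_eq_zero_of_mem_Xred (Yred_subset_Xred hred)
    by_cases h0 : u = 0
    · refine ⟨(⟨q, hq⟩, false), ?_⟩
      change redLine m n _ = arcLine _ (u : ℂ)
      rw [← arcLine_zero_eq, h0, Complex.ofReal_zero]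
    · by_cases h1 : u = 1
      · refine ⟨(⟨q, hq⟩, true), ?_⟩
        change redLine m n _ = arcLine _ (u : ℂ)
        rw [← arcLine_one_eq, h1, Complex.ofReal_one]
      · exact absurd hk (kappa_arcLine_ne_zero _ h0 h1)
  · rintro ⟨⟨q, b⟩, rfl⟩
    refine ⟨?_, redLine_mem_Yred hmn _⟩
    rw [hcl, Set.mem_iUnion₂]
    refine ⟨q.1, q.2, ?_⟩
    rw [closure_YirrComp q]
    cases b
    · exact ⟨0, Set.left_mem_Icc.mpr zero_le_one, by
        simp only [Complex.ofReal_zero]; exact arcLine_zero_eq hmn q⟩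
    · exact ⟨1, Set.right_mem_Icc.mpr zero_le_one, by
        simp only [Complex.ofReal_one]; exact arcLine_one_eq hmn q⟩

theorem ncard_closure_Yirr_inter_Yred (hm : 0 < m) (hn : 0 < n) (hmn : Nat.Coprime m n) :
    (closure (Yirr (KnotGroup m n)) ∩ Yred (KnotGroup m n)).ncard = (m - 1) * (n - 1) := by
  have hinj : Function.Injective fun x => redLine m n (endPoint hmn x : ℝ) := fun x y h =>
    endPoint_injective hmn (Subtype.ext (Complex.ofReal_injective
      ((redLine_isComplexLine hmn).injective h)))
  rw [closure_Yirr_inter_Yred hm hn hmn, ← Set.image_univ, Set.ncard_image_of_injective _ hinj,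
    Set.ncard_univ, Nat.card_prod, Nat.card_eq_fintype_card, Nat.card_eq_fintype_card,
    Fintype.card_bool, Fintype.card_coe, mul_comm, two_mul_card_indexPairs hmn]

theorem exists_homeomorph_Y (hm : 0 < m) (hn : 0 < n) (hmn : Nat.Coprime m n) :
    ∃ h : Attach (endPoint hmn) ≃ₜ Y (KnotGroup m n),
      (∀ s : Set.Icc (-2 : ℝ) 2,
        (h (Attach.base (endPoint hmn) s) : KnotGroup m n → ℂ) = redLine m n (s : ℝ)) ∧
      ∀ q (u : unitInterval),
        (h (Attach.arc (endPoint hmn) q u) : KnotGroup m n → ℂ) = arcLine q (u : ℝ) := by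
  have hred (s : Set.Icc (-2 : ℝ) 2) : redLine m n (s : ℝ) ∈ Y (KnotGroup m n) :=
    Yred_union_Yirr ▸ Or.inl (redLine_mem_Yred hmn s)
  have harc (q : {q // q ∈ indexPairs m n}) (u : unitInterval) :
      arcLine q (u : ℝ) ∈ Y (KnotGroup m n) := by
    obtain ⟨ρ, hρ⟩ := exists_su2_hasArcTraces q.2 u.2
    exact ⟨ρ, (hasArcTraces_arcLine q _).eq hρ⟩
  have coe_ne {u v : unitInterval} (h : u ≠ v) : (u : ℝ) ≠ v := fun e => h (Subtype.ext e)
  have mem {q : {q // q ∈ indexPairs m n}} {u : unitInterval} :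
      genValues (arcLine q (u : ℝ)) = eigTraces m n q.1 :=
    Prod.ext (hasArcTraces_arcLine q _).1 (hasArcTraces_arcLine q _).2.1
  obtain ⟨h, h1, h2⟩ := exists_homeomorph_attach (endPoint hmn)
    (fun s => (⟨_, hred s⟩ : Y (KnotGroup m n))) (fun q u => ⟨_, harc q u⟩)
    ((redLine_isComplexLine hmn).continuous.comp
      (Complex.continuous_ofReal.comp continuous_subtype_val) |>.subtype_mk _)
    (fun q => ((continuous_arcLine_real q).comp continuous_subtype_val).subtype_mk _)
    (fun q => Subtype.ext (by simpa using arcLine_zero_eq hmn q))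
    (fun q => Subtype.ext (by simpa using arcLine_one_eq hmn q))
    (fun s s' e => Subtype.ext (Complex.ofReal_injective
      ((redLine_isComplexLine hmn).injective (congrArg Subtype.val e))))
    (fun q q' u v _ _ e => by
      have e' : arcLine q (u : ℝ) = arcLine q' (v : ℝ) := congrArg Subtype.val e
      -- Arcs of different index differ already in the traces of the generators.
      have hq : q = q' := Subtype.ext (eigTraces_injOn q.2 q'.2
        (mem.symm.trans ((congrArg genValues e').trans mem)))
      subst hq
      exact ⟨rfl, Subtype.ext (Complex.ofReal_injective
        ((arcLine_isComplexLine q).injective e'))⟩)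
    (fun q u s h0 h1 e => by
      have e' : arcLine q (u : ℝ) = redLine m n (s : ℝ) := congrArg Subtype.val e
      refine kappa_arcLine_ne_zero q (coe_ne h0) (coe_ne h1) ?_
      rw [e', kappa_redLine])
    (fun ⟨χ, hχ⟩ => by
      rw [← Yred_union_Yirr] at hχ
      rcases hχ with h | h
      · rw [← redLine_image_Icc hmn] at h
        obtain ⟨s, hs, h⟩ := h
        exact Or.inl ⟨⟨s, hs⟩, Subtype.ext h⟩
      · rw [← iUnion_YirrComp hm hn, Set.mem_iUnion₂] at h
        obtain ⟨q, hq, h⟩ := h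
        rw [← arcLine_image_Ioo ⟨q, hq⟩] at h
        obtain ⟨u, hu, h⟩ := h
        exact Or.inr ⟨⟨q, hq⟩, ⟨u, Set.Ioo_subset_Icc_self hu⟩, Subtype.ext h⟩)
  exact ⟨h, fun s => congrArg Subtype.val (h1 s), fun q u => congrArg Subtype.val (h2 q u)⟩

end Main

end TorusKnot

end

theorem mainTheorem6 (m n : ℕ) (hm : 0 < m) (hn : 0 < n) (hmn : Nat.Coprime m n) :
    -- the decomposition of Y
    (TorusKnot.Y (TorusKnot.KnotGroup m n) ⊆ TorusKnot.X (TorusKnot.KnotGroup m n) ∧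
      TorusKnot.Yred (TorusKnot.KnotGroup m n) ∪ TorusKnot.Yirr (TorusKnot.KnotGroup m n)
        = TorusKnot.Y (TorusKnot.KnotGroup m n) ∧
      Disjoint (TorusKnot.Xred (TorusKnot.KnotGroup m n))
        (TorusKnot.Xirr (TorusKnot.KnotGroup m n))) ∧
    -- the number of intervals, and the number of points at which they are attached
    (TorusKnot.indexPairs m n).card = (m - 1) * (n - 1) / 2 ∧
    (closure (TorusKnot.Yirr (TorusKnot.KnotGroup m n)) ∩
      TorusKnot.Yred (TorusKnot.KnotGroup m n)).ncard = (m - 1) * (n - 1) ∧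
    -- the components of X_irr and of Y_irr
    (⋃ q ∈ TorusKnot.indexPairs m n, TorusKnot.XirrComp m n q)
      = TorusKnot.Xirr (TorusKnot.KnotGroup m n) ∧
    (⋃ q ∈ TorusKnot.indexPairs m n, TorusKnot.YirrComp m n q)
      = TorusKnot.Yirr (TorusKnot.KnotGroup m n) ∧
    (∀ q ∈ TorusKnot.indexPairs m n,
      (∀ χ ∈ TorusKnot.XirrComp m n q,
        connectedComponentIn (TorusKnot.Xirr (TorusKnot.KnotGroup m n)) χ
          = TorusKnot.XirrComp m n q) ∧
      (∀ χ ∈ TorusKnot.YirrComp m n q,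
        connectedComponentIn (TorusKnot.Yirr (TorusKnot.KnotGroup m n)) χ
          = TorusKnot.YirrComp m n q) ∧
      TorusKnot.YirrComp m n q
        = TorusKnot.Y (TorusKnot.KnotGroup m n) ∩ TorusKnot.XirrComp m n q) ∧
    (∀ q ∈ TorusKnot.indexPairs m n, ∀ q' ∈ TorusKnot.indexPairs m n, q ≠ q' →
      Disjoint (TorusKnot.XirrComp m n q) (TorusKnot.XirrComp m n q') ∧
      Disjoint (closure (TorusKnot.YirrComp m n q)) (closure (TorusKnot.YirrComp m n q'))) ∧
    -- the topological description
    ∃ (ℓ₀ : ℂ → TorusKnot.KnotGroup m n → ℂ)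
      (ℓ : {q // q ∈ TorusKnot.indexPairs m n} → ℂ → TorusKnot.KnotGroup m n → ℂ)
      (p : {q // q ∈ TorusKnot.indexPairs m n} × Bool → Set.Icc (-2 : ℝ) 2)
      (h : TorusKnot.Attach p ≃ₜ TorusKnot.Y (TorusKnot.KnotGroup m n)),
      -- X_red is a complex line with coordinate t + 1/t, and Y_red is [-2, 2] inside it
      TorusKnot.IsComplexLine ℓ₀ ∧
      Set.range ℓ₀ = TorusKnot.Xred (TorusKnot.KnotGroup m n) ∧
      (∀ (t : ℂ) (ρ : TorusKnot.KnotGroup m n →* TorusKnot.SL2C), t ≠ 0 →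
        (ρ (TorusKnot.genX m n)).1 = !![t ^ n, 0; 0, (t ^ n)⁻¹] →
        (ρ (TorusKnot.genY m n)).1 = !![t ^ m, 0; 0, (t ^ m)⁻¹] →
        TorusKnot.character ρ = ℓ₀ (t + t⁻¹)) ∧
      (fun s : ℝ => ℓ₀ (s : ℂ)) '' Set.Icc (-2) 2
        = TorusKnot.Yred (TorusKnot.KnotGroup m n) ∧
      -- each component of X_irr is a complex line without two points, and the interval of Y_irr
      -- in it is the open segment between these points
      (∀ q, TorusKnot.IsComplexLine (ℓ q) ∧
        ℓ q '' {0, 1}ᶜ = TorusKnot.XirrComp m n q.1 ∧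
        (fun u : ℝ => ℓ q (u : ℂ)) '' Set.Ioo 0 1 = TorusKnot.YirrComp m n q.1) ∧
      -- the points of attachment are all different, and are those with t ^ n = λ, t ^ m = μ
      -- and with t ^ n = λ, t ^ m = 1 / μ
      Function.Injective p ∧
      (∀ q, (∃ t : ℂ, t ^ n = TorusKnot.eig q.1.1 m ∧ t ^ m = TorusKnot.eig q.1.2 n ∧
          (((p (q, false)) : ℝ) : ℂ) = t + t⁻¹) ∧
        (∃ t : ℂ, t ^ n = TorusKnot.eig q.1.1 m ∧ t ^ m = (TorusKnot.eig q.1.2 n)⁻¹ ∧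
          (((p (q, true)) : ℝ) : ℂ) = t + t⁻¹)) ∧
      -- the homeomorphism is given by these lines
      (∀ s : Set.Icc (-2 : ℝ) 2,
        ((h (TorusKnot.Attach.base p s) : TorusKnot.Y (TorusKnot.KnotGroup m n)) :
          TorusKnot.KnotGroup m n → ℂ) = ℓ₀ ((s : ℝ) : ℂ)) ∧
      (∀ q (u : unitInterval),
        ((h (TorusKnot.Attach.arc p q u) : TorusKnot.Y (TorusKnot.KnotGroup m n)) :
          TorusKnot.KnotGroup m n → ℂ) = ℓ q ((u : ℝ) : ℂ)) := by
  refine ⟨⟨TorusKnot.Y_subset_X, TorusKnot.Yred_union_Yirr, TorusKnot.disjoint_Xred_Xirr⟩, ?_,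
    TorusKnot.ncard_closure_Yirr_inter_Yred hm hn hmn, TorusKnot.iUnion_XirrComp hm hn,
    TorusKnot.iUnion_YirrComp hm hn, fun q hq => ⟨fun χ hχ => ?_, fun χ hχ => ?_,
      TorusKnot.YirrComp_eq_inter q⟩,
    fun q hq q' hq' hne => ⟨TorusKnot.disjoint_XirrComp hq hq' hne,
      TorusKnot.disjoint_closure_YirrComp hq hq' hne⟩, ?_⟩
  · rw [← TorusKnot.two_mul_card_indexPairs hmn, Nat.mul_div_cancel_left _ two_pos]
  · exact TorusKnot.connectedComponentIn_eq_of_separating (TorusKnot.iUnion_XirrComp hm hn)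
      (fun _ => TorusKnot.isPreconnected_XirrComp) TorusKnot.continuous_genValues
      (fun _ _ _ => TorusKnot.genValues_of_mem_XirrComp) TorusKnot.eigTraces_injOn hq hχ
  · exact TorusKnot.connectedComponentIn_eq_of_separating (TorusKnot.iUnion_YirrComp hm hn)
      (fun _ => TorusKnot.isPreconnected_YirrComp) TorusKnot.continuous_genValues
      (fun r _ _ h => TorusKnot.genValues_of_mem_XirrComp (TorusKnot.YirrComp_subset_XirrComp r h))
      TorusKnot.eigTraces_injOn hq hχ
  · obtain ⟨h, hbase, harc⟩ := TorusKnot.exists_homeomorph_Y hm hn hmn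
    exact ⟨TorusKnot.redLine m n, TorusKnot.arcLine, TorusKnot.endPoint hmn, h,
      TorusKnot.redLine_isComplexLine hmn, TorusKnot.range_redLine hmn,
      fun _ _ ht hx hy => TorusKnot.character_eq_redLine ht hx hy,
      TorusKnot.redLine_image_Icc hmn,
      fun q => ⟨TorusKnot.arcLine_isComplexLine q, TorusKnot.arcLine_image_compl q,
        TorusKnot.arcLine_image_Ioo q⟩,
      TorusKnot.endPoint_injective hmn,
      fun q => ⟨TorusKnot.endPoint_spec hmn q false, TorusKnot.endPoint_spec hmn q true⟩,
      hbase, harc⟩
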